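/- Let $n\ge 0$ and $m\ge 1$ be integers, and work in $\mathbb{P}^n=\mathbb{P}^n_{\mathbb{C}}$. A closed subscheme $X\subset\mathbb{P}^n$ supported at exactly one point $P$ is called $m$-symmetric if $\ell(X\cap L)=m$ for every line $L$ through $P$, where $\ell$ denotes the length and $X\cap L$ the scheme-theoretic intersection. An $m$-superfat point is an $m$-symmetric scheme that is maximal with respect to inclusion among all $m$-symmetric schemes in $\mathbb{P}^n$. **Theorem.** 1. Let $X\subset\mathbb{P}^n$ be an $m$-superfat point, supported at $P$. Then $X$ is locally a complete intersection of $n$ hypersurfaces with multiplicity $m$ at $P$ whose tangent cones have no common line; that is, there are homogeneous polynomials $G_1,\dots,G_n\in\mathbb{C}[x_0,\dots,x_n]$ such that each hypersurface $\{G_i=0\}$ has multiplicity exactly $m$ at $P$, no line of $\mathbb{P}^n$ is contained in the tangent cones at $P$ of all these hypersurfaces, and $I_X\,\mathcal{O}_{\mathbb{P}^n,P}=(G_1,\dots,G_n)\,\mathcal{O}_{\mathbb{P}^n,P}$. Consequently $\ell(X)=m^n$. 2. The number $m^n$ is the maximal length of an $m$-symmetric scheme: every $m$-symmetric scheme in $\mathbb{P}^n$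 has length at most $m^n$, and there is one of length $m^n$. -/

import Mathlib

open MvPolynomial
open scoped LinearAlgebra.Projectivization

attribute [local instance] MvPolynomial.gradedAlgebra

noncomputable section

namespace Superfat

/-- The homogeneous coordinate ring `ℂ[x₀, …, xₙ]` of `ℙⁿ`. -/
abbrev CoordRing (n : ℕ) : Type := MvPolynomial (Fin (n + 1)) ℂ

/-- The standard grading of the coordinate ring by degree. -/
abbrev grading (n : ℕ) : ℕ → Submodule ℂ (CoordRing n) :=
  homogeneousSubmodule (Fin (n + 1)) ℂ

/-- The (closed) points of complex projective `n`-space. -/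
abbrev Point (n : ℕ) : Type := ℙ ℂ (Fin (n + 1) → ℂ)

/-- A closed subscheme `X` of `ℙⁿ`, given by its defining ideal `I_X`, a saturated homogeneous
ideal of the coordinate ring. Saturated homogeneous ideals are in inclusion-reversing bijection
with the closed subschemes of `ℙⁿ`; the empty subscheme has the unit ideal. -/
structure ClosedSubscheme (n : ℕ) where
  /-- The defining ideal. -/
  ideal : HomogeneousIdeal (grading n)
  /-- Saturation with respect to the irrelevant ideal `(x₀, …, xₙ)`. -/
  saturated : ∀ f : CoordRing n, (∀ i, ∃ k : ℕ, X i ^ k * f ∈ ideal) → f ∈ ideal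

/-- Scheme-theoretic inclusion. -/
instance (n : ℕ) : LE (ClosedSubscheme n) := ⟨fun Y Z => Z.ideal ≤ Y.ideal⟩

/-- The set of (closed) points of a closed subscheme. -/
def ClosedSubscheme.support {n : ℕ} (Y : ClosedSubscheme n) : Set (Point n) :=
  {Q | ∀ f ∈ Y.ideal, eval Q.rep f = 0}

theorem eval_smul_of_isHomogeneous {n k : ℕ} {f : CoordRing n} (hf : f.IsHomogeneous k)
    (t : ℂ) (w : Fin (n + 1) → ℂ) : eval (t • w) f = t ^ k * eval w f := by
  rw [eval_eq, eval_eq, Finset.mul_sum]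
  refine Finset.sum_congr rfl fun d hd => ?_
  have h := hf.degree_eq_sum_deg_support hd
  simp only [Pi.smul_apply, smul_eq_mul, mul_pow, Finset.prod_mul_distrib]
  rw [Finset.prod_pow_eq_pow_sum, ← h]
  ring

/-- A polynomial vanishes on a linear subspace `W` of `ℂⁿ⁺¹` iff all its homogeneous
components do. -/
theorem isHomogeneous_vanishingIdeal {n : ℕ} (W : Submodule ℂ (Fin (n + 1) → ℂ)) :
    (vanishingIdeal ℂ (W : Set (Fin (n + 1) → ℂ))).IsHomogeneous (grading n) := by
  intro d f hf
  rw [show (DirectSum.decompose (grading n) f d : CoordRing n) = homogeneousComponent d f from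
    decomposition.decompose'_apply f d]
  rw [mem_vanishingIdeal_iff] at hf ⊢
  intro w hw
  have key : (∑ k ∈ Finset.range (f.totalDegree + 1),
      Polynomial.monomial k (eval w (homogeneousComponent k f))) = (0 : Polynomial ℂ) := by
    apply Polynomial.funext
    intro t
    have h0 : eval (t • w) f = 0 := by
      have := hf (t • w) (W.smul_mem t hw)
      rwa [aeval_eq_eval] at this
    rw [← sum_homogeneousComponent f, map_sum] at h0
    rw [Polynomial.eval_finsetSum, Polynomial.eval_zero, ← h0]
    refine Finset.sum_congr rfl fun k _ => ?_
    rw [Polynomial.eval_monomial, eval_smul_of_isHomogeneous (homogeneousComponent_isHomogeneous k f),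
      mul_comm]
  rw [aeval_eq_eval]
  by_cases hd : d < f.totalDegree + 1
  · have := congrArg (fun p => Polynomial.coeff p d) key
    simpa [Polynomial.finsetSum_coeff, Polynomial.coeff_monomial, hd] using this
  · rw [homogeneousComponent_eq_zero d f (by omega), map_zero]

/-- The homogeneous ideal of the linear subvariety `ℙ(W)` of `ℙⁿ`: all polynomials that vanish
on the linear subspace `W` of `ℂⁿ⁺¹`. -/
def linearIdeal {n : ℕ} (W : Submodule ℂ (Fin (n + 1) → ℂ)) : HomogeneousIdeal (grading n) :=
  ⟨vanishingIdeal ℂ (W : Set (Fin (n + 1) → ℂ)), isHomogeneous_vanishingIdeal W⟩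

/-- The homogeneous ideal `I_P` of a point `P`. -/
def pointIdeal {n : ℕ} (P : Point n) : Ideal (CoordRing n) := (linearIdeal P.submodule).toIdeal

instance {n : ℕ} (P : Point n) : (pointIdeal P).IsPrime := by
  have h : pointIdeal P = RingHom.ker (aeval (R := ℂ)
      (fun i => Polynomial.C (P.rep i) * Polynomial.X)).toRingHom := by
    ext f
    have hev : ∀ t : ℂ, Polynomial.eval t (aeval (R := ℂ)
        (fun i => Polynomial.C (P.rep i) * Polynomial.X) f) = aeval (t • P.rep) f := by
      intro t
      rw [← Polynomial.coe_aeval_eq_eval, ← AlgHom.comp_apply, comp_aeval]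
      congr 2
      ext i
      rw [map_mul, Polynomial.aeval_C, Polynomial.aeval_X]
      exact mul_comm _ _
    rw [RingHom.mem_ker]
    change (f ∈ vanishingIdeal ℂ (P.submodule : Set (Fin (n + 1) → ℂ))) ↔ aeval _ f = _
    rw [mem_vanishingIdeal_iff, Projectivization.submodule_eq]
    constructor
    · intro hf
      apply Polynomial.funext
      intro t
      rw [hev, Polynomial.eval_zero]
      exact hf _ (Submodule.smul_mem _ t (Submodule.mem_span_singleton_self _))
    · intro hf x hx
      obtain ⟨t, rfl⟩ := Submodule.mem_span_singleton.1 hx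
      rw [← hev, hf, Polynomial.eval_zero]
  rw [h]
  exact RingHom.ker_isPrime _

/-- The local ring `𝒪_{ℙⁿ,P}`: fractions `f / g` of homogeneous polynomials of the same degree
with `g` not vanishing at `P`. -/
abbrev LocalRingAt {n : ℕ} (P : Point n) : Type :=
  HomogeneousLocalization.AtPrime (grading n) (pointIdeal P)

/-- The ideal of `𝒪_{ℙⁿ,P}` defined by an ideal `I` generated by homogeneous polynomials:
the elements of `𝒪_{ℙⁿ,P}` that lie in the extension of `I` to the localization of the coordinate
ring at `I_P`, i.e. the fractions `f / g` as above with `f ∈ I`. -/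
def localIdeal {n : ℕ} (I : Ideal (CoordRing n)) (P : Point n) : Ideal (LocalRingAt P) :=
  (I.map (algebraMap (CoordRing n) (Localization.AtPrime (pointIdeal P)))).comap
    (algebraMap (LocalRingAt P) (Localization.AtPrime (pointIdeal P)))

/-- The length of the closed subscheme of `ℙⁿ` defined by a homogeneous ideal `I` (which need not
be saturated): the sum over all points `Q` of the lengths of the local rings
`𝒪_{ℙⁿ,Q} / I 𝒪_{ℙⁿ,Q}`. -/
def length {n : ℕ} (I : HomogeneousIdeal (grading n)) : ℕ∞ :=
  ∑' Q : Point n, Module.length (LocalRingAt Q) (LocalRingAt Q ⧸ localIdeal I.toIdeal Q)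

/-- `Y` is an `m`-symmetric scheme: it is (0-dimensional and) supported at one point `P`, and
`ℓ(Y ∩ L) = m` for every line `L` through `P`. Lines are given by two-dimensional linear subspaces
`W` of `ℂⁿ⁺¹`, and `Y ∩ L` is the subscheme with ideal `I_Y + I_L`. -/
def IsSymmetric {n : ℕ} (m : ℕ) (Y : ClosedSubscheme n) : Prop :=
  ∃ P : Point n, Y.support = {P} ∧
    ∀ W : Submodule ℂ (Fin (n + 1) → ℂ), Module.finrank ℂ W = 2 → P.submodule ≤ W →
      length (Y.ideal ⊔ linearIdeal W) = m

/-- An `m`-superfat point: an `m`-symmetric scheme that is maximal with respect to inclusion. -/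
def IsSuperfat {n : ℕ} (m : ℕ) (Y : ClosedSubscheme n) : Prop :=
  Maximal (IsSymmetric m) Y

/-- The homogeneous part of degree `k`, in the variables `y`, of the Taylor expansion `G(p + y)`
of `G` at a representative `p` of `P`. -/
def taylorPart {n : ℕ} (G : CoordRing n) (P : Point n) (k : ℕ) : CoordRing n :=
  homogeneousComponent k (aeval (fun i => C (P.rep i) + X i) G)

/-- The hypersurface `G = 0` has multiplicity `m` at `P`. In this case its tangent cone at `P` is
the cone with vertex `P` in `ℙⁿ` defined by the form `taylorPart G P m` (for `P = [1, 0, …, 0]`,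
this is the form of lowest degree of `G(1, x₁, …, xₙ)`). -/
def HasMultiplicity {n : ℕ} (G : CoordRing n) (P : Point n) (m : ℕ) : Prop :=
  (∀ k < m, taylorPart G P k = 0) ∧ taylorPart G P m ≠ 0

end Superfat

end

/-! ### Regularity with respect to an ideal filtration, and lengths. -/

section FilteredRegular

variable {R : Type*} [CommRing R]

/-! Take a frame whose chart is centred at `P`, let `M` be the ideal of the origin, and let `𝔞` be
the ideal of an `m`-symmetric scheme in the chart. The length of the intersection with a line
through `P` is the least order of vanishing of `𝔞` along that line. Hence `m`-symmetry says exactly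
that `𝔞 ≤ M ^ m` and that the degree `m` parts of the elements of `𝔞` have no common zero besides
the origin (`le_pow_and_exists_of_isSymmetric`, `isSymmetric_of_le_pow`).

The core is to find `g₁, …, gₙ` in `𝔞` whose degree `m` forms already have no common nontrivial
zero, and to compute their multiplicity (`exists_exchange`). Start from the coordinates, which have
length `1`, and exchange one coordinate at a time for an element of `𝔞`. The initial forms of the
elements that stay have only finitely many common zeros up to scaling. A vector space over an
infinite field is not a finite union of proper subspaces, so some element of `𝔞` has a degree `m`
form that avoids all of them. Each exchange multiplies the length by `m`
(`FilteredRegular.length_exchange`): multiplication by the new element shifts the order by `m`, just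
as `m` multiplications by the coordinate do, and all these maps are strictly injective modulo the
other elements.

The `gᵢ` may have zeros away from the origin, so lengths are taken modulo `(g) + M ^ N` for large
`N`. By Nakayama this ideal agrees with `(g)` near the origin. Its closure `Z` is an `m`-symmetric
complete intersection at `P` of length `m ^ n` containing the given scheme
(`exists_le_complete_intersection`). This bounds the length by `m ^ n`; a superfat point equals its
`Z` by maximality; and a fat point of order `m` provides a scheme to start from. -/

/-- Multiplication by `a`, an element of order `d` for the `M`-adic filtration, is strictly
injective on `R ⧸ I`: a multiple `a * g` has order at least `k + d` modulo `I` only if `g` has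
order at least `k` modulo `I`. -/
def FilteredRegular (M : Ideal R) (a : R) (d : ℕ) (I : Ideal R) : Prop :=
  ∀ k g, a * g ∈ I ⊔ M ^ (k + d) → g ∈ I ⊔ M ^ k

theorem Ideal.mem_sup_span_singleton_sup {I K : Ideal R} {a x : R} :
    x ∈ I ⊔ Ideal.span {a} ⊔ K ↔ ∃ c, x - a * c ∈ I ⊔ K := by
  rw [sup_right_comm, Submodule.mem_sup]
  constructor
  · rintro ⟨y, hy, z, hz, rfl⟩
    obtain ⟨c, rfl⟩ := Ideal.mem_span_singleton'.1 hz
    exact ⟨c, by rwa [mul_comm a, add_sub_cancel_right]⟩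
  · rintro ⟨c, hc⟩
    exact ⟨_, hc, a * c, Ideal.mem_span_singleton.2 (dvd_mul_right _ _), sub_add_cancel _ _⟩

variable {M I : Ideal R} {a b l : R} {d e m : ℕ}

/-- A filtered form of descending regularity from `R ⧸ (I, a)` to `R ⧸ I`. If `b * g` is small, then
`g` is `a * c` up to order `k`, and cancelling `a` shows that `b * c` is small. This is the same
problem with `k` lowered by `d`, so induction applies because `d ≥ 1`. -/
theorem FilteredRegular.of_sup (hd : 1 ≤ d) (ha : a ∈ M ^ d) (hb : b ∈ M ^ e)
    (hbI : FilteredRegular M b e (I ⊔ Ideal.span {a})) (haI : FilteredRegular M a d I) :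
    FilteredRegular M b e I := by
  intro k
  induction k using Nat.strong_induction_on with
  | _ k ih =>
    intro g hg
    have h1 := hbI k g (sup_le_sup_right (le_sup_left : I ≤ I ⊔ Ideal.span {a}) _ hg)
    obtain ⟨c, hc⟩ := Ideal.mem_sup_span_singleton_sup.1 h1
    have h2 : b * (g - a * c) ∈ I ⊔ M ^ (k + e) := by
      obtain ⟨x, hx, y, hy, hxy⟩ := Submodule.mem_sup.1 hc
      rw [← hxy, mul_add]
      refine Submodule.add_mem_sup (I.mul_mem_left _ hx) ?_
      rw [pow_add, mul_comm b]
      exact Ideal.mul_mem_mul hy hb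
    have h3 : a * (b * c) ∈ I ⊔ M ^ (k + e) := by
      have := sub_mem hg h2
      convert this using 1
      ring
    have h4 : a * c ∈ I ⊔ M ^ k := by
      -- For `k ≤ d` the factor `a` alone already gives `a * c` order `k`.
      by_cases hk : k ≤ d
      · exact Ideal.mem_sup_right (Ideal.mul_mem_right _ _ (Ideal.pow_le_pow_right hk ha))
      · have h5 : b * c ∈ I ⊔ M ^ (k - d + e) :=
          haI _ _ (by rwa [show k - d + e + d = k + e by omega])
        have h6 := ih (k - d) (by omega) c h5
        obtain ⟨x, hx, y, hy, hxy⟩ := Submodule.mem_sup.1 h6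
        rw [← hxy, mul_add]
        refine Submodule.add_mem_sup (I.mul_mem_left _ hx) ?_
        rw [show k = d + (k - d) by omega, pow_add]
        exact Ideal.mul_mem_mul ha (by simpa using hy)
    have := add_mem hc h4
    rwa [sub_add_cancel] at this

/-- Regular sequences of length two may be permuted: a relation `a * g = b * h` modulo `I` makes `h`
a multiple of `a`, up to high order, and `a` can then be cancelled. -/
theorem FilteredRegular.sup_swap (hb : b ∈ M ^ e)
    (haI : FilteredRegular M a d I) (hbI : FilteredRegular M b e (I ⊔ Ideal.span {a})) :
    FilteredRegular M a d (I ⊔ Ideal.span {b}) := by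
  intro k g hg
  obtain ⟨h, hh⟩ := Ideal.mem_sup_span_singleton_sup.1 hg
  by_cases hk : k + d ≤ e
  · have h1 : a * g ∈ I ⊔ M ^ (k + d) := by
      have h2 : b * h ∈ I ⊔ M ^ (k + d) :=
        Ideal.mem_sup_right (Ideal.mul_mem_right _ _ (Ideal.pow_le_pow_right hk hb))
      have := add_mem hh h2
      rwa [sub_add_cancel] at this
    exact sup_le_sup_right (le_sup_left : I ≤ I ⊔ Ideal.span {b}) _ (haI k g h1)
  · have h1 : b * h ∈ I ⊔ Ideal.span {a} ⊔ M ^ (k + d - e + e) := by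
      rw [show k + d - e + e = k + d by omega, Ideal.mem_sup_span_singleton_sup]
      refine ⟨g, ?_⟩
      have := neg_mem hh
      rwa [neg_sub] at this
    obtain ⟨h', hh'⟩ := Ideal.mem_sup_span_singleton_sup.1 (hbI _ _ h1)
    have h2 : b * (h - a * h') ∈ I ⊔ M ^ (k + d) := by
      obtain ⟨x, hx, y, hy, hxy⟩ := Submodule.mem_sup.1 hh'
      rw [← hxy, mul_add]
      refine Submodule.add_mem_sup (I.mul_mem_left _ hx) ?_
      rw [show k + d = e + (k + d - e) by omega, pow_add]
      exact Ideal.mul_mem_mul hb hy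
    have h3 : a * (g - b * h') ∈ I ⊔ M ^ (k + d) := by
      have := add_mem hh h2
      convert this using 1
      ring
    exact Ideal.mem_sup_span_singleton_sup.2 ⟨h', haI _ _ h3⟩

/-- If `b * g` is small, so is `l ^ r * g`, because `l ^ r` is a multiple of `b` modulo `I` with a
coefficient of the expected order `r - m`. The powers of `l` are then peeled off one by one. The
error term in `M ^ N` is harmless since `N` is arbitrary. -/
theorem FilteredRegular.of_pow_mem (hl : FilteredRegular M l 1 I) {r : ℕ} (hr : m ≤ r)
    (h : ∀ N, l ^ r ∈ I ⊔ M ^ (r - m) * Ideal.span {b} ⊔ M ^ N) : FilteredRegular M b m I := by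
  intro k g hg
  have h1 : ∀ j, ∀ x, l ^ j * x ∈ I ⊔ M ^ (k + j) → x ∈ I ⊔ M ^ k := by
    intro j
    induction j with
    | zero => intro x hx; simpa using hx
    | succ j ih =>
      intro x hx
      refine ih x (hl _ _ ?_)
      rwa [add_assoc, ← mul_assoc, ← pow_succ']
  refine h1 r g ?_
  obtain ⟨y, hy, z, hz, hyz⟩ := Submodule.mem_sup.1 (h (k + r))
  obtain ⟨x, hx, w, hw, rfl⟩ := Submodule.mem_sup.1 hy
  obtain ⟨c, hc, rfl⟩ := Ideal.mem_mul_span_singleton.1 hw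
  rw [← hyz, add_mul, add_mul]
  refine add_mem (add_mem (Ideal.mem_sup_left (I.mul_mem_right _ hx)) ?_)
    (Ideal.mem_sup_right (Ideal.mul_mem_right _ _ hz))
  rw [mul_assoc]
  obtain ⟨u, hu, v, hv, huv⟩ := Submodule.mem_sup.1 hg
  rw [← huv, mul_add]
  refine Submodule.add_mem_sup (I.mul_mem_left _ hu) ?_
  rw [show k + r = (r - m) + (k + m) by omega, pow_add]
  exact Ideal.mul_mem_mul hc hv

/-- Every member of the family `f` acts strictly injectively modulo any of the other members. -/
def IsFilteredRegularFamily {ι : Type*} (M : Ideal R) (f : ι → R) (d : ι → ℕ) : Prop :=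
  ∀ (T : Set ι) (i : ι), i ∉ T → FilteredRegular M (f i) (d i) (Ideal.span (f '' T))

theorem Ideal.span_image_insert {ι : Type*} (f : ι → R) (i : ι) (T : Set ι) :
    Ideal.span (f '' insert i T) = Ideal.span (f '' T) ⊔ Ideal.span {f i} := by
  rw [Set.image_insert_eq, Ideal.span_insert, sup_comm]

/-- Regularity of the new member need only be known modulo all the others: `FilteredRegular.of_sup`
removes members from the modulus one at a time, and `FilteredRegular.sup_swap` treats the old
members modulo sets containing the new one. -/
theorem IsFilteredRegularFamily.update {ι : Type*} [Finite ι] [DecidableEq ι] {f : ι → R}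
    {d : ι → ℕ}
    (hf : IsFilteredRegularFamily M f d) (hd : ∀ i, 1 ≤ d i) (hfd : ∀ i, f i ∈ M ^ d i) {k : ι}
    (hb : b ∈ M ^ m) (hreg : FilteredRegular M b m (Ideal.span (f '' {k}ᶜ))) :
    IsFilteredRegularFamily M (Function.update f k b) (Function.update d k m) := by
  have hbT : ∀ T : Set ι, k ∉ T → FilteredRegular M b m (Ideal.span (f '' T)) := by
    intro T hT
    have key : ∀ U : Set ι, k ∉ U →
        FilteredRegular M b m (Ideal.span (f '' (U ∪ T))) →
        FilteredRegular M b m (Ideal.span (f '' T)) := by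
      intro U
      induction U, U.toFinite using Set.Finite.induction_on with
      | empty => simp
      | @insert i U _ _ ih =>
        intro hU h
        rw [Set.insert_union] at h
        by_cases hi : i ∈ U ∪ T
        · rw [Set.insert_eq_of_mem hi] at h
          exact ih (fun h => hU (Or.inr h)) h
        · rw [Ideal.span_image_insert] at h
          exact ih (fun h => hU (Or.inr h)) (h.of_sup (hd i) (hfd i) hb (hf _ _ hi))
    refine key {k}ᶜ (by simp) ?_
    rwa [Set.union_eq_left.2 (by simpa using hT)]
  have himage : ∀ T : Set ι, k ∉ T → Function.update f k b '' T = f '' T := fun T hT =>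
    Set.image_congr fun i hi => Function.update_of_ne (by rintro rfl; exact hT hi) _ _
  intro T i hi
  by_cases hik : i = k
  · subst hik
    rw [himage T hi]
    simpa using hbT T hi
  · rw [Function.update_of_ne hik, Function.update_of_ne hik]
    by_cases hk : k ∈ T
    · have hkT : k ∉ T \ {k} := by simp
      have hT : insert k (T \ {k}) = T := by simpa using hk
      rw [← hT, Ideal.span_image_insert, himage _ hkT, Function.update_self]
      refine FilteredRegular.sup_swap hb (hf _ _ fun h => hi h.1) ?_
      rw [← Ideal.span_image_insert]
      exact hbT _ (by simp [Ne.symm hik])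
    · rw [himage T hk]
      exact hf T i hi

/-- Additivity of length along `0 → R ⧸ A → R ⧸ B → R ⧸ (B + (b)) → 0`, where the first map is
multiplication by `b`. -/
theorem Ideal.length_quotient_eq_add {A B : Ideal R} (b : R) (h : ∀ g, b * g ∈ B ↔ g ∈ A) :
    Module.length R (R ⧸ B) =
      Module.length R (R ⧸ A) + Module.length R (R ⧸ (B ⊔ Ideal.span {b})) := by
  have hle : A ≤ Submodule.comap (LinearMap.mulLeft R b) B := fun g hg => (h g).2 hg
  refine Module.length_eq_add_of_exact (Submodule.mapQ A B (LinearMap.mulLeft R b) hle)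
    (Submodule.factor le_sup_left) ?_ (Submodule.factor_surjective _) ?_
  · rw [← LinearMap.ker_eq_bot, LinearMap.ker_eq_bot']
    intro x hx
    obtain ⟨g, rfl⟩ := Submodule.Quotient.mk_surjective _ x
    rw [Submodule.mapQ_apply, Submodule.Quotient.mk_eq_zero] at hx
    rw [Submodule.Quotient.mk_eq_zero]
    exact (h g).1 hx
  · intro x
    obtain ⟨g, rfl⟩ := Submodule.Quotient.mk_surjective _ x
    change Submodule.Quotient.mk g = 0 ↔ _
    rw [Submodule.Quotient.mk_eq_zero, sup_comm, Ideal.mem_span_singleton_sup]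
    constructor
    · rintro ⟨a, c, hc, rfl⟩
      refine ⟨Submodule.Quotient.mk a, ?_⟩
      rw [Submodule.mapQ_apply, Submodule.Quotient.eq, LinearMap.mulLeft_apply, mul_comm,
        sub_add_cancel_left]
      exact neg_mem hc
    · rintro ⟨y, hy⟩
      obtain ⟨c, rfl⟩ := Submodule.Quotient.mk_surjective _ y
      rw [Submodule.mapQ_apply, Submodule.Quotient.eq, LinearMap.mulLeft_apply] at hy
      exact ⟨c, g - b * c, by simpa using neg_mem hy, by ring⟩

theorem FilteredRegular.length_eq (hb : b ∈ M ^ m) (h : FilteredRegular M b m I) (k : ℕ) :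
    Module.length R (R ⧸ (I ⊔ M ^ (k + m))) =
      Module.length R (R ⧸ (I ⊔ M ^ k)) +
        Module.length R (R ⧸ (I ⊔ Ideal.span {b} ⊔ M ^ (k + m))) := by
  rw [sup_right_comm]
  refine Ideal.length_quotient_eq_add b fun g => ⟨h k g, fun hg => ?_⟩
  obtain ⟨u, hu, v, hv, rfl⟩ := Submodule.mem_sup.1 hg
  rw [mul_add, add_comm k m, pow_add]
  exact Submodule.add_mem_sup (I.mul_mem_left _ hu) (Ideal.mul_mem_mul hb hv)

/-- Exchanging, in a parameter system, an element of order `1` for an element of order `m`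
multiplies the length of the quotient by `m`. -/
theorem FilteredRegular.length_exchange (hfin : ∀ k, Module.length R (R ⧸ (I ⊔ M ^ k)) ≠ ⊤)
    (hl : l ∈ M) (hb : b ∈ M ^ m) (hlI : FilteredRegular M l 1 I) (hbI : FilteredRegular M b m I)
    {c : ℕ∞} {r : ℕ} (hc : ∀ N ≥ r, Module.length R (R ⧸ (I ⊔ Ideal.span {l} ⊔ M ^ N)) = c) :
    ∀ N ≥ r + m, Module.length R (R ⧸ (I ⊔ Ideal.span {b} ⊔ M ^ N)) = m * c := by
  intro N hN
  obtain ⟨k, rfl⟩ : ∃ k, N = k + m := ⟨N - m, by omega⟩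
  -- Each multiplication by `l` raises the order by one with a cokernel of length `c`. Going from
  -- `k` to `k + m` in this way costs `m * c`, which is compared with the single multiplication by
  -- `b`; the common term is finite and cancels.
  have h1 : ∀ j, Module.length R (R ⧸ (I ⊔ M ^ (k + j))) =
      Module.length R (R ⧸ (I ⊔ M ^ k)) + j * c := by
    intro j
    induction j with
    | zero => simp
    | succ j ih =>
      rw [← add_assoc, hlI.length_eq (by simpa using hl), ih, hc _ (by omega)]
      push_cast
      ring
  have h2 := hbI.length_eq hb k
  rw [h1] at h2
  exact ((WithTop.add_left_inj (hfin k)).1 h2).symm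

end FilteredRegular

/-! ### Polynomials filtered by order at the origin, and their initial forms. -/

namespace MvPolynomial

section Semiring

variable {σ R : Type*} [CommSemiring R]

theorem decompose_homogeneousSubmodule_apply (s : MvPolynomial σ R) (e : ℕ) :
    (DirectSum.decompose (homogeneousSubmodule σ R) s e : MvPolynomial σ R) =
      homogeneousComponent e s :=
  decomposition.decompose'_apply s e

theorem homogeneousComponent_mul_of_isHomogeneous {a F : MvPolynomial σ R} {d e : ℕ}
    (hF : F.IsHomogeneous d) (h : d ≤ e) :
    homogeneousComponent e (a * F) = homogeneousComponent (e - d) a * F := by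
  have := DirectSum.coe_decompose_mul_of_right_mem_of_le (homogeneousSubmodule σ R)
    (a := a) (b := F) hF h
  simpa only [decompose_homogeneousSubmodule_apply] using this

end Semiring

section Ring

variable {σ R : Type*} [CommRing R]

theorem IsHomogeneous.mem_pow_idealOfVars {s : MvPolynomial σ R} {d : ℕ}
    (hs : s.IsHomogeneous d) : s ∈ idealOfVars σ R ^ d := by
  rw [mem_pow_idealOfVars_iff']
  intro x hx
  exact hs.coeff_eq_zero (by omega)

theorem sub_homogeneousComponent_mem_pow {s : MvPolynomial σ R} {d : ℕ}
    (hs : s ∈ idealOfVars σ R ^ d) :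
    s - homogeneousComponent d s ∈ idealOfVars σ R ^ (d + 1) := by
  rw [mem_pow_idealOfVars_iff'] at hs ⊢
  intro x hx
  rw [coeff_sub, coeff_homogeneousComponent]
  split_ifs with h
  · simp
  · simp [hs x (by omega)]

theorem mem_pow_idealOfVars_iff_homogeneousComponent {s : MvPolynomial σ R} {d : ℕ} :
    s ∈ idealOfVars σ R ^ d ↔ ∀ e < d, homogeneousComponent e s = 0 := by
  rw [mem_pow_idealOfVars_iff']
  constructor
  · intro h e he
    ext x
    rw [coeff_homogeneousComponent, coeff_zero]
    split_ifs with hx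
    · exact h x (by omega)
    · rfl
  · intro h x hx
    have := congrArg (coeff x) (h _ hx)
    simpa [coeff_homogeneousComponent] using this

theorem totalDegree_sub_homogeneousComponent_le {s : MvPolynomial σ R} {e : ℕ}
    (hs : s.totalDegree ≤ e + 1) : (s - homogeneousComponent (e + 1) s).totalDegree ≤ e := by
  rw [totalDegree, Finset.sup_le_iff]
  intro x hx
  rw [mem_support_iff, coeff_sub, coeff_homogeneousComponent] at hx
  split_ifs at hx with h
  · simp at hx
  · have h1 : coeff x s ≠ 0 := by simpa using hx
    have h2 : x.degree ≤ s.totalDegree := le_totalDegree (mem_support_iff.2 h1)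
    change x.degree ≤ e
    omega

/-- If modulo `I` every form of degree larger than `r` can be rewritten in lower degree, then the
quotient by `I` is a finite module. -/
theorem finite_quotient_of_forall_isHomogeneous [Finite σ] {I : Ideal (MvPolynomial σ R)} (r : ℕ)
    (h : ∀ e ≥ r, ∀ s : MvPolynomial σ R, s.IsHomogeneous (e + 1) →
      ∃ s', s'.totalDegree ≤ e ∧ s - s' ∈ I) :
    Module.Finite R (MvPolynomial σ R ⧸ I) := by
  have key : ∀ e, ∀ s : MvPolynomial σ R, s.totalDegree ≤ e →
      ∃ s', s'.totalDegree ≤ r ∧ s - s' ∈ I := by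
    intro e
    induction e with
    | zero => exact fun s hs => ⟨s, by omega, by simp⟩
    | succ e ih =>
      intro s hs
      by_cases he : e + 1 ≤ r
      · exact ⟨s, by omega, by simp⟩
      · obtain ⟨t, ht, hst⟩ := h e (by omega) _ (homogeneousComponent_isHomogeneous (e + 1) s)
        obtain ⟨s', hs', hss'⟩ := ih (s - homogeneousComponent (e + 1) s + t)
          ((totalDegree_add _ _).trans
            (max_le (totalDegree_sub_homogeneousComponent_le hs) ht))
        refine ⟨s', hs', ?_⟩
        have := add_mem hss' hst
        convert this using 1
        ring
  refine Module.Finite.of_surjective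
    ((Ideal.Quotient.mkₐ R I).toLinearMap ∘ₗ (restrictTotalDegree σ R r).subtype) ?_
  intro x
  obtain ⟨s, rfl⟩ := Ideal.Quotient.mk_surjective x
  obtain ⟨s', hs', hss'⟩ := key _ s le_rfl
  exact ⟨⟨s', (mem_restrictTotalDegree _ _ _).2 hs'⟩, (Ideal.Quotient.eq.2 hss').symm⟩

theorem finite_quotient_of_pow_idealOfVars_le [Finite σ] {I : Ideal (MvPolynomial σ R)} {N : ℕ}
    (h : idealOfVars σ R ^ N ≤ I) : Module.Finite R (MvPolynomial σ R ⧸ I) :=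
  finite_quotient_of_forall_isHomogeneous N fun e he s hs =>
    ⟨0, by simp, by simpa using h (Ideal.pow_le_pow_right (by omega) hs.mem_pow_idealOfVars)⟩

end Ring

section Field

variable {σ K : Type*} [Field K]

theorem length_quotient_ne_top [Finite σ] {I : Ideal (MvPolynomial σ K)} {N : ℕ}
    (h : idealOfVars σ K ^ N ≤ I) :
    Module.length (MvPolynomial σ K) (MvPolynomial σ K ⧸ I) ≠ ⊤ := by
  have := finite_quotient_of_pow_idealOfVars_le h
  have : IsArtinian (MvPolynomial σ K) (MvPolynomial σ K ⧸ I) := isArtinian_of_tower K inferInstance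
  exact Module.length_ne_top

/-- Common zeros are distinct `K`-algebra homomorphisms from the quotient to `K`, and a finite
algebra has only finitely many of these. -/
theorem finite_zeros [Finite σ] {I : Ideal (MvPolynomial σ K)}
    (h : Module.Finite K (MvPolynomial σ K ⧸ I)) : {v : σ → K | ∀ s ∈ I, eval v s = 0}.Finite := by
  have := Finite.algHom K (MvPolynomial σ K ⧸ I) K
  let φ : {v : σ → K | ∀ s ∈ I, eval v s = 0} → (MvPolynomial σ K ⧸ I →ₐ[K] K) := fun v =>
    Ideal.Quotient.liftₐ I (aeval v.1) (fun s hs => by rw [aeval_eq_eval]; exact v.2 s hs)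
  refine Set.finite_coe_iff.1 (Finite.of_injective φ fun v w hvw => ?_)
  refine Subtype.ext (_root_.funext fun i => ?_)
  have := DFunLike.congr_fun hvw (Ideal.Quotient.mk I (X i))
  simpa [φ] using this

variable [IsAlgClosed K] {ι : Type*} [Fintype ι]

/-- By the Nullstellensatz, forms without a common nontrivial zero generate an ideal containing a
power of the ideal of the variables. Taking homogeneous components of the resulting combinations
makes the coefficients forms of the expected degree. -/
theorem exists_forall_isHomogeneous_eq_sum [Finite σ] {F : ι → MvPolynomial σ K} {d : ι → ℕ}
    (hF : ∀ i, (F i).IsHomogeneous (d i)) (h0 : ∀ v, (∀ i, eval v (F i) = 0) → v = 0) :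
    ∃ r₀, (∀ i, d i ≤ r₀) ∧ ∀ r ≥ r₀, ∀ s : MvPolynomial σ K, s.IsHomogeneous r →
      ∃ a : ι → MvPolynomial σ K, (∀ i, (a i).IsHomogeneous (r - d i)) ∧ s = ∑ i, a i * F i := by
  have hrad : idealOfVars σ K ≤ (Ideal.span (Set.range F)).radical := by
    rw [← vanishingIdeal_zeroLocus_eq_radical (K := K), Ideal.span_le]
    rintro _ ⟨j, rfl⟩
    rw [SetLike.mem_coe, mem_vanishingIdeal_iff]
    intro v hv
    have : v = 0 := h0 v fun i => by
      have := hv (F i) (Ideal.subset_span ⟨i, rfl⟩)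
      rwa [aeval_eq_eval] at this
    simp [this]
  obtain ⟨r₁, hr₁⟩ := Ideal.exists_pow_le_of_le_radical_of_fg hrad (idealOfVars_fg σ K)
  -- Adding the sum of all degrees keeps every subtraction `r - d i` from being truncated.
  refine ⟨r₁ + ∑ i, d i, fun i => ?_, fun r hr s hs => ?_⟩
  · exact (Finset.single_le_sum (fun _ _ => Nat.zero_le _) (Finset.mem_univ i)).trans
      (Nat.le_add_left _ _)
  · have hsF := hr₁ (Ideal.pow_le_pow_right (by omega) hs.mem_pow_idealOfVars)
    obtain ⟨c, hc⟩ := Ideal.mem_span_range_iff_exists_fun.1 hsF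
    refine ⟨fun i => homogeneousComponent (r - d i) (c i),
      fun i => homogeneousComponent_isHomogeneous _ _, ?_⟩
    rw [← homogeneousComponent_eq_self hs, ← hc, map_sum]
    refine Finset.sum_congr rfl fun i _ => ?_
    refine homogeneousComponent_mul_of_isHomogeneous (hF i) ?_
    have := Finset.single_le_sum (f := d) (fun _ _ => Nat.zero_le _) (Finset.mem_univ i)
    omega

/-- If the initial forms of the `f i` have no common zero, then, up to terms of high order, all
polynomials of order `r ≫ 0` are combinations of the `f i` with coefficients of order `r - d i`. -/
theorem exists_pow_idealOfVars_le [Finite σ] {f : ι → MvPolynomial σ K} {d : ι → ℕ}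
    (hf : ∀ i, f i ∈ idealOfVars σ K ^ d i)
    (h0 : ∀ v, (∀ i, eval v (homogeneousComponent (d i) (f i)) = 0) → v = 0) :
    ∃ r₀, (∀ i, d i ≤ r₀) ∧ ∀ r ≥ r₀, ∀ N, idealOfVars σ K ^ r ≤
      (⨆ i, idealOfVars σ K ^ (r - d i) * Ideal.span {f i}) ⊔ idealOfVars σ K ^ N := by
  obtain ⟨r₀, hd, hr₀⟩ := exists_forall_isHomogeneous_eq_sum
    (fun i => homogeneousComponent_isHomogeneous (d i) (f i)) h0
  -- Replacing each initial form by `f i` itself changes a combination of degree `r` only in order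
  -- at least `r + 1`. Iterating pushes the error into an arbitrary `M ^ N`.
  have step : ∀ r ≥ r₀, idealOfVars σ K ^ r ≤
      (⨆ i, idealOfVars σ K ^ (r - d i) * Ideal.span {f i}) ⊔ idealOfVars σ K ^ (r + 1) := by
    intro r hr
    rw [pow_idealOfVars_eq_span r, Ideal.span_le]
    rintro _ ⟨x, hx, rfl⟩
    obtain ⟨a, ha, hs⟩ := hr₀ r hr _ (isHomogeneous_monomial (1 : K) hx)
    have : monomial x (1 : K) = ∑ i, a i * f i +
        ∑ i, -(a i * (f i - homogeneousComponent (d i) (f i))) := by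
      rw [hs, ← Finset.sum_add_distrib]
      exact Finset.sum_congr rfl fun i _ => by ring
    beta_reduce
    rw [this]
    refine Submodule.add_mem_sup (Submodule.sum_mem_iSup fun i => ?_) (sum_mem fun i _ => ?_)
    · exact Ideal.mul_mem_mul (ha i).mem_pow_idealOfVars (Ideal.mem_span_singleton_self _)
    · rw [show r + 1 = (r - d i) + (d i + 1) by have := hd i; omega, pow_add]
      exact neg_mem (Ideal.mul_mem_mul (ha i).mem_pow_idealOfVars
        (sub_homogeneousComponent_mem_pow (hf i)))
  have iter : ∀ r ≥ r₀, ∀ j, idealOfVars σ K ^ r ≤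
      (⨆ i, idealOfVars σ K ^ (r - d i) * Ideal.span {f i}) ⊔ idealOfVars σ K ^ (r + j) := by
    intro r hr j
    induction j with
    | zero => exact le_sup_right
    | succ j ih =>
      refine ih.trans (sup_le le_sup_left ((step (r + j) (by omega)).trans ?_))
      refine sup_le_sup_right (iSup_mono fun i => ?_) _
      exact Ideal.mul_mono_left (Ideal.pow_le_pow_right (by omega))
  refine ⟨r₀, hd, fun r hr N => (iter r hr N).trans ?_⟩
  exact sup_le_sup_left (Ideal.pow_le_pow_right (by omega)) _

end Field

end MvPolynomial

/-! ### The exchange process, from the coordinates to a complete intersection. -/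

namespace MvPolynomial

theorem IsHomogeneous.aeval_smul {σ R A : Type*} [CommSemiring R] [CommSemiring A] [Algebra R A]
    {f : MvPolynomial σ R} {k : ℕ} (hf : f.IsHomogeneous k) (t : A) (w : σ → A) :
    MvPolynomial.aeval (t • w) f = t ^ k * MvPolynomial.aeval w f := by
  rw [aeval_def, aeval_def, eval₂_eq, eval₂_eq, Finset.mul_sum]
  refine Finset.sum_congr rfl fun d hd => ?_
  have h := hf.degree_eq_sum_deg_support hd
  simp only [Pi.smul_apply, smul_eq_mul, mul_pow, Finset.prod_mul_distrib]
  rw [Finset.prod_pow_eq_pow_sum, ← h]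
  ring

theorem IsHomogeneous.eval_smul {σ R : Type*} [CommSemiring R] {f : MvPolynomial σ R} {k : ℕ}
    (hf : f.IsHomogeneous k) (t : R) (w : σ → R) : eval (t • w) f = t ^ k * eval w f := by
  simpa only [aeval_eq_eval] using hf.aeval_smul t w

theorem homogeneousComponent_one_X {σ R : Type*} [CommSemiring R] (i : σ) :
    homogeneousComponent 1 (X i : MvPolynomial σ R) = X i :=
  homogeneousComponent_eq_self (isHomogeneous_X R i)

section CommRing

variable {σ R : Type*} [CommRing R]

theorem mem_span_X_image_sup_pow {T : Set σ} {k : ℕ} {s : MvPolynomial σ R} :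
    s ∈ Ideal.span (X '' T) ⊔ idealOfVars σ R ^ k ↔
      ∀ x ∈ s.support, (∃ i ∈ T, x i ≠ 0) ∨ k ≤ x.degree := by
  constructor
  · intro h x hx
    obtain ⟨u, hu, v, hv, rfl⟩ := Submodule.mem_sup.1 h
    rw [mem_ideal_span_X_image] at hu
    rw [mem_pow_idealOfVars_iff] at hv
    classical
    rcases Finset.mem_union.1 (support_add hx) with h | h
    · exact Or.inl (hu x h)
    · exact Or.inr (hv x h)
  · intro h
    rw [s.as_sum]
    refine sum_mem fun x hx => ?_
    rcases h x hx with h | h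
    · refine Ideal.mem_sup_left (mem_ideal_span_X_image.2 fun y hy => ?_)
      rw [Finset.mem_singleton.1 (support_monomial_subset hy)]
      exact h
    · refine Ideal.mem_sup_right ((mem_pow_idealOfVars_iff _ _).2 fun y hy => ?_)
      rw [Finset.mem_singleton.1 (support_monomial_subset hy)]
      exact h

/-- All ideals involved are monomial, and multiplication by a variable only shifts exponents. -/
theorem isFilteredRegularFamily_X :
    IsFilteredRegularFamily (idealOfVars σ R) X (fun _ => 1) := by
  intro T i hi k g hg
  rw [mem_span_X_image_sup_pow] at hg ⊢
  intro x hx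
  rcases hg (x + Finsupp.single i 1) (by
    rw [mem_support_iff] at hx ⊢
    rwa [add_comm, coeff_X_mul]) with ⟨t, ht, hxt⟩ | h
  · refine Or.inl ⟨t, ht, ?_⟩
    have : t ≠ i := by rintro rfl; exact hi ht
    simpa [Finsupp.single_apply, this.symm] using hxt
  · rw [map_add, Finsupp.degree_single] at h
    exact Or.inr (Nat.le_of_add_le_add_right h)

end CommRing

section Field

variable {σ K : Type*} [Field K]

theorem idealOfVars_eq_ker : idealOfVars σ K = RingHom.ker (constantCoeff (R := K) (σ := σ)) := by
  ext s
  rw [RingHom.mem_ker, constantCoeff_eq, ← pow_one (idealOfVars σ K), mem_pow_idealOfVars_iff']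
  simp [Finsupp.degree_eq_zero_iff]

instance isMaximal_idealOfVars : (idealOfVars σ K).IsMaximal := by
  rw [idealOfVars_eq_ker]
  exact RingHom.ker_isMaximal_of_surjective _ fun c => ⟨C c, by simp⟩

theorem length_quotient_idealOfVars :
    Module.length (MvPolynomial σ K) (MvPolynomial σ K ⧸ idealOfVars σ K) = 1 := by
  rw [Module.length_eq_one_iff, isSimpleModule_iff_isCoatom]
  exact Ideal.isMaximal_def.1 inferInstance

variable [IsAlgClosed K] {ι : Type*} [Fintype ι]

/-- Together with `X k` the forms have only the trivial zero, so every form of large degree is `a *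
X k` modulo the `F i`. On the slice `X k = 1` it reduces to `a`, of lower degree, hence the
coordinate ring of the slice is finite over `K`. -/
theorem finite_zeros_slice [Finite σ] {F : ι → MvPolynomial σ K} {d : ι → ℕ} (k : σ)
    (hF : ∀ i, (F i).IsHomogeneous (d i))
    (h0 : ∀ v : σ → K, v k = 0 → (∀ i, eval v (F i) = 0) → v = 0) :
    {v : σ → K | v k = 1 ∧ ∀ i, eval v (F i) = 0}.Finite := by
  obtain ⟨r, -, hr⟩ := exists_forall_isHomogeneous_eq_sum (ι := Option ι)
    (F := fun i => i.elim (X k) F) (d := fun i => i.elim 1 d)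
    (fun i => by cases i with
      | none => exact isHomogeneous_X K k
      | some i => exact hF i)
    (fun v hv => h0 v (by simpa using hv none) fun i => hv (some i))
  let I := Ideal.span (Set.range F) ⊔ Ideal.span {X k - 1}
  have hfin : Module.Finite K (MvPolynomial σ K ⧸ I) := by
    refine finite_quotient_of_forall_isHomogeneous r fun e he s hs => ?_
    obtain ⟨a, ha, rfl⟩ := hr (e + 1) (by omega) s hs
    refine ⟨a none, by simpa using (ha none).totalDegree_le, ?_⟩
    rw [Fintype.sum_option]
    have : a none * (X k - 1) + ∑ i, a (some i) * F i ∈ I :=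
      add_mem (Ideal.mem_sup_right (Ideal.mul_mem_left _ _ (Ideal.mem_span_singleton_self _)))
        (Ideal.mem_sup_left (sum_mem fun i _ => Ideal.mul_mem_left _ _ (Ideal.subset_span ⟨i, rfl⟩)))
    convert this using 1
    simp only [Option.elim]
    ring
  refine (finite_zeros hfin).subset ?_
  rintro v ⟨hk, hv⟩ s hs
  have hI : I ≤ RingHom.ker (eval v) := by
    refine sup_le (Ideal.span_le.2 ?_) (Ideal.span_le.2 ?_)
    · rintro _ ⟨i, rfl⟩
      exact hv i
    · rintro _ rfl
      simp [hk]
  exact hI hs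

/-- For each `v` in `Z`, the elements of `𝔞` whose degree `m` form vanishes at `v` make up a proper
subspace, and finitely many proper subspaces do not cover `𝔞`. -/
theorem exists_mem_forall_eval_homogeneousComponent_ne_zero {m : ℕ} {𝔞 : Ideal (MvPolynomial σ K)}
    (h : ∀ v : σ → K, v ≠ 0 → ∃ s ∈ 𝔞, eval v (homogeneousComponent m s) ≠ 0)
    {Z : Set (σ → K)} (hZ : Z.Finite) (hZ0 : 0 ∉ Z) :
    ∃ s ∈ 𝔞, ∀ v ∈ Z, eval v (homogeneousComponent m s) ≠ 0 := by
  have := hZ.to_subtype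
  let φ : Z → Module.Dual K (𝔞.restrictScalars K) := fun v =>
    (aeval (R := K) v.1).toLinearMap ∘ₗ homogeneousComponent m ∘ₗ
      (𝔞.restrictScalars K).subtype
  by_contra! hcon
  obtain ⟨v, hv⟩ := Subspace.exists_eq_top_of_iUnion_eq_univ (p := fun v => LinearMap.ker (φ v)) (by
    rw [Set.eq_univ_iff_forall]
    intro s
    obtain ⟨v, hv, h0⟩ := hcon s.1 s.2
    exact Set.mem_iUnion.2 ⟨⟨v, hv⟩, by simpa [φ, aeval_eq_eval] using h0⟩)
  obtain ⟨s, hs, hsv⟩ := h v.1 (fun h => hZ0 (h ▸ v.2))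
  have : (⟨s, hs⟩ : 𝔞.restrictScalars K) ∈ LinearMap.ker (φ v) := by rw [hv]; trivial
  exact hsv (by simpa [φ, aeval_eq_eval] using this)

/-- Induction on the number `j` of coordinates already replaced. Besides the length, the induction
carries the absence of common zeros of the initial forms, which makes the next finite set of zeros
available, and the regularity of the family, which makes the length computation possible. -/
theorem exists_exchange {n m : ℕ} (hm : 1 ≤ m) {𝔞 : Ideal (MvPolynomial (Fin n) K)}
    (h1 : 𝔞 ≤ idealOfVars (Fin n) K ^ m)
    (h2 : ∀ v : Fin n → K, v ≠ 0 → ∃ s ∈ 𝔞, eval v (homogeneousComponent m s) ≠ 0) (j : ℕ)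
    (hj : j ≤ n) : ∃ (f : Fin n → MvPolynomial (Fin n) K) (d : Fin n → ℕ),
      (∀ i : Fin n, i.val < j → f i ∈ 𝔞 ∧ d i = m) ∧
      (∀ i : Fin n, j ≤ i.val → f i = X i ∧ d i = 1) ∧
      (∀ i, f i ∈ idealOfVars (Fin n) K ^ d i) ∧ (∀ i, 1 ≤ d i) ∧
      (∀ i, homogeneousComponent (d i) (f i) ≠ 0) ∧
      (∀ v, (∀ i, eval v (homogeneousComponent (d i) (f i)) = 0) → v = 0) ∧
      IsFilteredRegularFamily (idealOfVars (Fin n) K) f d ∧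
      ∃ r, ∀ N ≥ r, Module.length (MvPolynomial (Fin n) K) (MvPolynomial (Fin n) K ⧸
        (Ideal.span (Set.range f) ⊔ idealOfVars (Fin n) K ^ N)) = (m : ℕ∞) ^ j := by
  induction j with
  | zero =>
    refine ⟨X, fun _ => 1, by simp, by simp, fun i => ?_, by simp, fun i => ?_, fun v hv => ?_,
      isFilteredRegularFamily_X, 1, fun N hN => ?_⟩
    · exact (isHomogeneous_X K i).mem_pow_idealOfVars
    · rw [homogeneousComponent_one_X]
      exact X_ne_zero i
    · exact _root_.funext fun i => by simpa [homogeneousComponent_one_X] using hv i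
    · rw [sup_eq_left.2 (Ideal.pow_le_self (by omega)), length_quotient_idealOfVars, pow_zero]
  | succ j ih =>
    obtain ⟨f, d, hlt, hge, hfd, hd, hne, h0, hreg, r, hr⟩ := ih (by omega)
    let k : Fin n := ⟨j, by omega⟩
    obtain ⟨hfk, hdk⟩ := hge k le_rfl
    have hFk : homogeneousComponent (d k) (f k) = X k := by
      rw [hfk, hdk, homogeneousComponent_one_X]
    have hslice : ∀ v : Fin n → K, v k = 0 → (∀ i : {i // i ≠ k},
        eval v (homogeneousComponent (d i) (f i)) = 0) → v = 0 := by
      refine fun v hv h => h0 v fun i => ?_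
      by_cases hi : i = k
      · rw [hi, hFk, eval_X, hv]
      · exact h ⟨i, hi⟩
    have hZ := finite_zeros_slice k
      (fun i : {i // i ≠ k} => homogeneousComponent_isHomogeneous (d i) (f i)) hslice
    -- The extra point `Pi.single k 1` guarantees that the initial form of `b` is nonzero without
    -- having to know that the slice has a zero.
    obtain ⟨b, hb, hbZ⟩ := exists_mem_forall_eval_homogeneousComponent_ne_zero h2
      (hZ.insert (Pi.single k 1)) (by simp [Set.mem_insert_iff, eq_comm (a := (0 : Fin n → K))])
    have hbm := h1 hb
    let f' := Function.update f k b
    let d' := Function.update d k m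
    have hf'k : f' k = b := Function.update_self ..
    have hd'k : d' k = m := Function.update_self ..
    have hf'i : ∀ i ≠ k, f' i = f i := fun i hi => Function.update_of_ne hi ..
    have hd'i : ∀ i ≠ k, d' i = d i := fun i hi => Function.update_of_ne hi ..
    have hfd' : ∀ i, f' i ∈ idealOfVars (Fin n) K ^ d' i := by
      intro i
      by_cases hi : i = k
      · rwa [hi, hf'k, hd'k]
      · rw [hf'i i hi, hd'i i hi]
        exact hfd i
    have h0' : ∀ v, (∀ i, eval v (homogeneousComponent (d' i) (f' i)) = 0) → v = 0 := by
      intro v hv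
      have hv' : ∀ i : {i // i ≠ k}, eval v (homogeneousComponent (d i) (f i)) = 0 := fun i => by
        rw [← hf'i i i.2, ← hd'i i i.2]
        exact hv i
      by_contra hv0
      -- A nontrivial common zero of the new forms lies off the hyperplane of the old coordinate, so
      -- it can be scaled into the slice, where `b` was chosen not to vanish.
      have hvk : v k ≠ 0 := fun h => hv0 (hslice v h hv')
      refine hbZ ((v k)⁻¹ • v) (Or.inr ⟨by simp [hvk], fun i => ?_⟩) ?_
      · rw [(homogeneousComponent_isHomogeneous _ _).eval_smul, hv' i, mul_zero]
      · rw [(homogeneousComponent_isHomogeneous _ _).eval_smul]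
        have := hv k
        rw [hf'k, hd'k] at this
        rw [this, mul_zero]
    have hbreg : FilteredRegular (idealOfVars (Fin n) K) b m (Ideal.span (f '' {k}ᶜ)) := by
      obtain ⟨r₀, hr₀d, hr₀⟩ := exists_pow_idealOfVars_le hfd' h0'
      have hl := hreg {k}ᶜ k (by simp)
      rw [hdk] at hl
      -- The new initial forms have no common zero, so a high power of the old coordinate is a
      -- combination of the new family. This yields regularity of `b` from that of the coordinate.
      refine hl.of_pow_mem (r := r₀) (hd'k ▸ hr₀d k) fun N => ?_
      have hle : (⨆ i, idealOfVars (Fin n) K ^ (r₀ - d' i) * Ideal.span {f' i}) ≤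
          Ideal.span (f '' {k}ᶜ) ⊔ idealOfVars (Fin n) K ^ (r₀ - m) * Ideal.span {b} := by
        refine iSup_le fun i => ?_
        by_cases hi : i = k
        · rw [hi, hf'k, hd'k]
          exact le_sup_right
        · refine le_sup_of_le_left (Ideal.mul_le_right.trans ?_)
          rw [hf'i i hi]
          exact Ideal.span_mono (Set.singleton_subset_iff.2 ⟨i, hi, rfl⟩)
      refine sup_le_sup_right hle _ (hr₀ r₀ le_rfl N (Ideal.pow_mem_pow ?_ _))
      rw [hfk]
      exact Ideal.subset_span ⟨k, rfl⟩
    have hspan : ∀ g : Fin n → MvPolynomial (Fin n) K, (∀ i ≠ k, g i = f i) →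
        Ideal.span (Set.range g) = Ideal.span (f '' {k}ᶜ) ⊔ Ideal.span {g k} := by
      intro g hg
      rw [← Set.image_univ, ← Set.insert_eq_of_mem (Set.mem_univ k),
        ← Set.insert_sdiff_singleton, Ideal.span_image_insert, ← Set.compl_eq_univ_sdiff]
      congr 2
      exact Set.image_congr fun i hi => hg i hi
    refine ⟨f', d', fun i hi => ?_, fun i hi => ?_, hfd', fun i => ?_, fun i => ?_, h0',
      hreg.update hd hfd hbm hbreg, r + m, fun N hN => ?_⟩
    · by_cases hik : i = k
      · rw [hik]
        exact ⟨hf'k ▸ hb, hd'k⟩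
      · rw [hf'i i hik, hd'i i hik]
        have : i.val ≠ j := fun h => hik (Fin.ext h)
        exact hlt i (by omega)
    · have hik : i ≠ k := by rintro rfl; simp [k] at hi
      rw [hf'i i hik, hd'i i hik]
      exact hge i (by omega)
    · by_cases hik : i = k
      · rw [hik, hd'k]
        exact hm
      · rw [hd'i i hik]
        exact hd i
    · by_cases hik : i = k
      · rw [hik, hd'k, hf'k]
        intro h
        exact hbZ _ (Or.inl rfl) (by rw [h, map_zero])
      · rw [hf'i i hik, hd'i i hik]
        exact hne i
    · have hl := hreg {k}ᶜ k (by simp)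
      rw [hdk] at hl
      rw [hspan f' hf'i, hf'k, pow_succ']
      refine FilteredRegular.length_exchange (l := f k) (r := r)
        (fun k => length_quotient_ne_top le_sup_right) ?_ hbm hl hbreg (fun N hN => ?_) N hN
      · simpa [hdk] using hfd k
      · rw [← hspan f fun _ _ => rfl]
        exact hr N hN

/-- An ideal of order `m` whose initial forms of degree `m` have no common zero contains a
complete intersection of multiplicity `m ^ n` with the same property. -/
theorem exists_complete_intersection {n m : ℕ} (hm : 1 ≤ m) {𝔞 : Ideal (MvPolynomial (Fin n) K)}
    (h1 : 𝔞 ≤ idealOfVars (Fin n) K ^ m)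
    (h2 : ∀ v : Fin n → K, v ≠ 0 → ∃ s ∈ 𝔞, eval v (homogeneousComponent m s) ≠ 0) :
    ∃ G : Fin n → MvPolynomial (Fin n) K, (∀ i, G i ∈ 𝔞) ∧
      (∀ i, homogeneousComponent m (G i) ≠ 0) ∧
      (∀ v, (∀ i, eval v (homogeneousComponent m (G i)) = 0) → v = 0) ∧
      ∃ r, ∀ N ≥ r,
        idealOfVars (Fin n) K ^ r ≤ Ideal.span (Set.range G) ⊔ idealOfVars (Fin n) K ^ N ∧
        Module.length (MvPolynomial (Fin n) K) (MvPolynomial (Fin n) K ⧸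
          (Ideal.span (Set.range G) ⊔ idealOfVars (Fin n) K ^ N)) = (m : ℕ∞) ^ n := by
  obtain ⟨G, d, hlt, -, hfd, -, hne, h0, -, r, hr⟩ := exists_exchange hm h1 h2 n le_rfl
  have hd : d = fun _ => m := _root_.funext fun i => (hlt i i.2).2
  subst hd
  obtain ⟨r₀, -, hr₀⟩ := exists_pow_idealOfVars_le hfd h0
  refine ⟨G, fun i => (hlt i i.2).1, hne, h0, max r r₀, fun N hN =>
    ⟨(Ideal.pow_le_pow_right (le_max_right _ _)).trans ((hr₀ r₀ le_rfl N).trans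
      (sup_le_sup_right (iSup_le fun i => ?_) _)), hr N (le_of_max_le_left hN)⟩⟩
  exact Ideal.mul_le_right.trans (Ideal.span_mono (Set.singleton_subset_iff.2 ⟨i, rfl⟩))

end Field

end MvPolynomial

/-! ### Affine charts, homogenization and localization at a point. -/

noncomputable section

namespace Superfat

variable {n : ℕ}

/-- The coordinate ring of the affine chart of `ℙⁿ` centered at a point. -/
abbrev AffineRing (n : ℕ) : Type := MvPolynomial (Fin n) ℂ

/-- Linear automorphisms of `ℂⁿ⁺¹`, regarded as systems of coordinates. -/
abbrev Frame (n : ℕ) : Type := (Fin (n + 1) → ℂ) ≃ₗ[ℂ] (Fin (n + 1) → ℂ)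

theorem exists_frame (P : Point n) : ∃ B : Frame n, B (Pi.single 0 1) = P.rep := by
  obtain ⟨A, hA⟩ := SeparatingDual.exists_continuousLinearEquiv_apply_eq (R := ℂ)
    (V := Fin (n + 1) → ℂ) (x := Pi.single 0 1) (y := P.rep) (by simp) P.rep_nonzero
  exact ⟨A.toLinearEquiv, hA⟩

variable (B : Frame n)

/-- Dehomogenization: the restriction of a polynomial to the affine chart `z ↦ B (1, z)`. -/
def dehom : CoordRing n →ₐ[ℂ] AffineRing n :=
  aeval fun i => C (B (Pi.single 0 1) i) + ∑ j, X j * C (B (Pi.single j.succ 1) i)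

theorem frame_apply (w : Fin (n + 1) → ℂ) (i : Fin (n + 1)) :
    B w i = ∑ k, w k * B (Pi.single k 1) i := by
  conv_lhs => rw [← Finset.univ_sum_single w, map_sum]
  rw [Finset.sum_apply]
  refine Finset.sum_congr rfl fun k _ => ?_
  rw [← mul_one (w k), ← smul_eq_mul, Pi.single_smul, map_smul]
  simp

theorem eval_dehom (z : Fin n → ℂ) (f : CoordRing n) :
    eval z (dehom B f) = eval (B (Fin.cons 1 z)) f := by
  rw [dehom, ← aeval_eq_eval, ← aeval_eq_eval, ← AlgHom.comp_apply, comp_aeval]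
  congr 2
  ext i
  simp [frame_apply B (Fin.cons 1 z), Fin.sum_univ_succ]

/-- The linear form giving the `k`-th coordinate with respect to the frame `B`. -/
def coordForm (k : Fin (n + 1)) : CoordRing n := ∑ i, C (B.symm (Pi.single i 1) k) * X i

theorem eval_coordForm (k : Fin (n + 1)) (w : Fin (n + 1) → ℂ) :
    eval w (coordForm B k) = B.symm w k := by
  rw [frame_apply B.symm, coordForm, map_sum]
  simp [mul_comm]

theorem isHomogeneous_coordForm (k : Fin (n + 1)) : (coordForm B k).IsHomogeneous 1 :=
  IsHomogeneous.sum _ _ _ fun _ _ => isHomogeneous_C_mul_X _ _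

/-- The polynomial on `ℂⁿ⁺¹` that does not depend on the coordinate `0` and restricts to a given
polynomial on the affine chart. -/
def cone : AffineRing n →ₐ[ℂ] CoordRing n := aeval fun j => coordForm B j.succ

theorem eval_cone (w : Fin (n + 1) → ℂ) (s : AffineRing n) :
    eval w (cone B s) = eval (fun j : Fin n => B.symm w j.succ) s := by
  rw [cone, ← aeval_eq_eval, ← aeval_eq_eval, ← AlgHom.comp_apply, comp_aeval]
  congr 2
  ext i
  simp [eval_coordForm]

theorem isHomogeneous_cone {s : AffineRing n} {k : ℕ} (hs : s.IsHomogeneous k) :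
    (cone B s).IsHomogeneous k := by
  have := hs.aeval _ fun j => isHomogeneous_coordForm B j.succ
  rwa [one_mul] at this

theorem dehom_cone (s : AffineRing n) : dehom B (cone B s) = s :=
  MvPolynomial.funext fun z => by simp [eval_dehom, eval_cone]

theorem dehom_coordForm_zero : dehom B (coordForm B 0) = 1 :=
  MvPolynomial.funext fun z => by simp [eval_dehom, eval_coordForm]

theorem dehom_surjective : Function.Surjective (dehom B) := fun s => ⟨_, dehom_cone B s⟩

/-- Homogenization in degree `d`. -/
def homogenize (d : ℕ) (s : AffineRing n) : CoordRing n :=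
  ∑ k ∈ Finset.range (d + 1), coordForm B 0 ^ (d - k) * cone B (homogeneousComponent k s)

theorem isHomogeneous_coordForm_pow (k : Fin (n + 1)) (d : ℕ) :
    (coordForm B k ^ d).IsHomogeneous d := by
  simpa using (isHomogeneous_coordForm B k).pow d

theorem isHomogeneous_homogenize (d : ℕ) (s : AffineRing n) :
    (homogenize B d s).IsHomogeneous d := by
  refine IsHomogeneous.sum _ _ _ fun k hk => ?_
  have := (isHomogeneous_coordForm_pow B 0 (d - k)).mul
    (isHomogeneous_cone B (homogeneousComponent_isHomogeneous k s))
  rwa [Nat.sub_add_cancel (Nat.lt_succ_iff.1 (Finset.mem_range.1 hk))] at this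

theorem sum_range_homogeneousComponent {σ R : Type*} [CommSemiring R] {s : MvPolynomial σ R} {d : ℕ}
    (hs : s.totalDegree ≤ d) : ∑ k ∈ Finset.range (d + 1), homogeneousComponent k s = s := by
  conv_rhs => rw [← sum_homogeneousComponent s]
  refine (Finset.sum_subset (by simpa using hs) fun k _ hk => ?_).symm
  exact homogeneousComponent_eq_zero _ _ (by simpa using hk)

theorem dehom_homogenize {d : ℕ} {s : AffineRing n} (hs : s.totalDegree ≤ d) :
    dehom B (homogenize B d s) = s := by
  rw [homogenize, map_sum]
  simp only [map_mul, map_pow, dehom_coordForm_zero, one_pow, one_mul, dehom_cone]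
  exact sum_range_homogeneousComponent hs

theorem coordForm_zero_ne_zero : coordForm B 0 ≠ 0 := fun h => by
  simpa [h] using dehom_coordForm_zero B

theorem eq_of_dehom_eq {f g : CoordRing n} {d : ℕ} (hf : f.IsHomogeneous d)
    (hg : g.IsHomogeneous d) (h : dehom B f = dehom B g) : f = g := by
  -- The factor `coordForm B 0` vanishes on the hyperplane at infinity, so values need comparing
  -- only at multiples of points of the chart.
  refine mul_left_cancel₀ (coordForm_zero_ne_zero B) (MvPolynomial.funext fun w => ?_)
  rw [map_mul, map_mul, eval_coordForm]
  by_cases hw : B.symm w 0 = 0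
  · rw [hw, zero_mul, zero_mul]
  · obtain ⟨z, hz⟩ : ∃ z : Fin n → ℂ, w = B.symm w 0 • B (Fin.cons 1 z) := by
      refine ⟨fun j => (B.symm w 0)⁻¹ * B.symm w j.succ, ?_⟩
      rw [← map_smul, ← B.symm_apply_eq]
      ext i
      refine Fin.cases ?_ (fun j => ?_) i <;> simp [hw]
    rw [hz, hf.eval_smul, hg.eval_smul, ← eval_dehom, ← eval_dehom, h]

theorem exists_isHomogeneous_of_mem_map {I : Ideal (CoordRing n)} (hI : I.IsHomogeneous (grading n))
    {s : AffineRing n} (hs : s ∈ I.map (dehom B)) :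
    ∃ d, ∃ f ∈ I, f.IsHomogeneous d ∧ dehom B f = s := by
  obtain ⟨f, hf, rfl⟩ := (Ideal.mem_map_iff_of_surjective _ (dehom_surjective B)).1 hs
  refine ⟨f.totalDegree, ∑ k ∈ Finset.range (f.totalDegree + 1),
    coordForm B 0 ^ (f.totalDegree - k) * homogeneousComponent k f, ?_, ?_, ?_⟩
  · exact sum_mem fun k _ => I.mul_mem_left _ (homogeneousComponent_mem_of_mem hI hf k)
  · refine IsHomogeneous.sum _ _ _ fun k hk => ?_
    have := (isHomogeneous_coordForm_pow B 0 (f.totalDegree - k)).mul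
      (homogeneousComponent_isHomogeneous k f)
    rwa [Nat.sub_add_cancel (Nat.lt_succ_iff.1 (Finset.mem_range.1 hk))] at this
  · simp only [map_sum, map_mul, map_pow, dehom_coordForm_zero, one_pow, one_mul]
    rw [← map_sum, sum_homogeneousComponent]

variable {B} {P : Point n}

theorem frame_cons_zero (hB : B (Pi.single 0 1) = P.rep) : B (Fin.cons 1 0) = P.rep := by
  rw [← hB]
  congr 1
  ext i
  refine Fin.cases ?_ (fun j => ?_) i <;> simp

theorem constantCoeff_dehom (hB : B (Pi.single 0 1) = P.rep) (f : CoordRing n) :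
    constantCoeff (dehom B f) = eval P.rep f := by
  rw [← frame_cons_zero hB, ← eval_dehom, eval_zero]

theorem mem_pointIdeal_iff {f : CoordRing n} :
    f ∈ pointIdeal P ↔ ∀ c : ℂ, eval (c • P.rep) f = 0 := by
  change f ∈ vanishingIdeal ℂ (P.submodule : Set (Fin (n + 1) → ℂ)) ↔ _
  rw [mem_vanishingIdeal_iff, Projectivization.submodule_eq]
  constructor
  · intro h c
    rw [← aeval_eq_eval]
    exact h _ (Submodule.smul_mem _ c (Submodule.mem_span_singleton_self _))
  · intro h x hx
    obtain ⟨c, rfl⟩ := Submodule.mem_span_singleton.1 hx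
    rw [aeval_eq_eval]
    exact h c

theorem notMem_pointIdeal_of_eval_ne_zero {f : CoordRing n} (hf : eval P.rep f ≠ 0) :
    f ∉ pointIdeal P := fun h => hf (by simpa using mem_pointIdeal_iff.1 h 1)

theorem eval_ne_zero_of_notMem_pointIdeal {f : CoordRing n} {d : ℕ} (hd : f.IsHomogeneous d)
    (hf : f ∉ pointIdeal P) : eval P.rep f ≠ 0 := fun h => hf <| mem_pointIdeal_iff.2 fun c => by
  rw [hd.eval_smul, h, mul_zero]

theorem coordForm_zero_notMem (hB : B (Pi.single 0 1) = P.rep) : coordForm B 0 ∉ pointIdeal P :=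
  notMem_pointIdeal_of_eval_ne_zero (by rw [eval_coordForm, ← hB]; simp)

/-- Homogenizing `u` turns the relation on the chart into one in the coordinate ring; powers of the
form at infinity, which is nonzero at `P`, make the degrees of both sides equal. -/
theorem exists_isHomogeneous_mul_mem (hB : B (Pi.single 0 1) = P.rep) {I : Ideal (CoordRing n)}
    (hI : I.IsHomogeneous (grading n)) {f : CoordRing n} {d : ℕ} (hf : f.IsHomogeneous d)
    {u : AffineRing n} (hu : constantCoeff u ≠ 0) (huf : u * dehom B f ∈ I.map (dehom B)) :
    ∃ e, ∃ g : CoordRing n, g.IsHomogeneous e ∧ eval P.rep g ≠ 0 ∧ g * f ∈ I := by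
  obtain ⟨D, h, hhI, hhD, hh⟩ := exists_isHomogeneous_of_mem_map B hI huf
  let g := homogenize B u.totalDegree u
  have hg : dehom B g = u := dehom_homogenize B le_rfl
  refine ⟨_, coordForm B 0 ^ D * g, (isHomogeneous_coordForm_pow B 0 D).mul
    (isHomogeneous_homogenize B _ u), ?_, ?_⟩
  · rw [← constantCoeff_dehom hB, map_mul, hg, map_pow, dehom_coordForm_zero, one_pow, one_mul]
    exact hu
  · have : coordForm B 0 ^ D * g * f = coordForm B 0 ^ (u.totalDegree + d) * h := by
      refine eq_of_dehom_eq B (d := D + u.totalDegree + d) ?_ ?_ ?_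
      · exact ((isHomogeneous_coordForm_pow B 0 D).mul (isHomogeneous_homogenize B _ u)).mul hf
      · rw [show D + u.totalDegree + d = u.totalDegree + d + D by ring]
        exact (isHomogeneous_coordForm_pow B 0 _).mul hhD
      · simp [dehom_coordForm_zero, hg, hh]
    rw [this]
    exact I.mul_mem_left _ hhI

/-- Membership in the localization at `P` of a homogeneous ideal, in terms of the affine chart. -/
theorem algebraMap_mem_map_iff (hB : B (Pi.single 0 1) = P.rep) {I : Ideal (CoordRing n)}
    (hI : I.IsHomogeneous (grading n)) {f : CoordRing n} {d : ℕ} (hf : f.IsHomogeneous d) :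
    algebraMap (CoordRing n) (Localization.AtPrime (pointIdeal P)) f ∈
      I.map (algebraMap (CoordRing n) (Localization.AtPrime (pointIdeal P))) ↔
    ∃ u : AffineRing n, constantCoeff u ≠ 0 ∧ u * dehom B f ∈ I.map (dehom B) := by
  rw [IsLocalization.algebraMap_mem_map_algebraMap_iff (pointIdeal P).primeCompl]
  constructor
  · rintro ⟨g, hg, hgf⟩
    obtain ⟨e, he⟩ : ∃ e, homogeneousComponent e g ∉ pointIdeal P := by
      by_contra! h
      exact hg ((mem_iff_homogeneousComponent_mem (linearIdeal P.submodule).isHomogeneous g).2 h)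
    refine ⟨dehom B (homogeneousComponent e g), ?_, ?_⟩
    · rw [constantCoeff_dehom hB]
      exact eval_ne_zero_of_notMem_pointIdeal (homogeneousComponent_isHomogeneous e g) he
    · rw [← map_mul]
      refine Ideal.mem_map_of_mem _ ?_
      have := homogeneousComponent_mem_of_mem hI hgf (e + d)
      rwa [homogeneousComponent_mul_of_isHomogeneous hf (by omega), Nat.add_sub_cancel] at this
  · rintro ⟨u, hu, huf⟩
    obtain ⟨e, g, -, hg, hgf⟩ := exists_isHomogeneous_mul_mem hB hI hf hu huf
    exact ⟨g, notMem_pointIdeal_of_eval_ne_zero hg, hgf⟩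

end Superfat

end

/-! ### The local ring at a point and lengths computed in a chart. -/

noncomputable section

namespace Superfat

variable {n : ℕ} {B : Frame n} {P : Point n}

theorem length_quotient_ker {R T : Type*} [CommRing R] [CommRing T] {φ : R →+* T}
    (hφ : Function.Surjective φ) : Module.length R (R ⧸ RingHom.ker φ) = Module.length T T := by
  let _ : Algebra R T := φ.toAlgebra
  rw [← Module.length_eq_of_surjective (S := R) (R := T) (M := T) hφ]
  exact ((Algebra.linearMap R T).quotKerEquivOfSurjective hφ).length_eq

theorem length_quotient_comap {R T : Type*} [CommRing R] [CommRing T] {φ : R →+* T}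
    (hφ : Function.Surjective φ) (J : Ideal T) :
    Module.length R (R ⧸ J.comap φ) = Module.length T (T ⧸ J) := by
  have h : Function.Surjective ((Ideal.Quotient.mk J).comp φ) :=
    Ideal.Quotient.mk_surjective.comp hφ
  rw [Module.length_eq_of_surjective (S := T) (R := T ⧸ J) (M := T ⧸ J)
    Ideal.Quotient.mk_surjective, ← length_quotient_ker h, ← RingHom.comap_ker, Ideal.mk_ker]

theorem exists_mul_sub_one_mem_pow {u : AffineRing n} (hu : constantCoeff u ≠ 0) (N : ℕ) :
    ∃ w, w * u - 1 ∈ idealOfVars (Fin n) ℂ ^ N := by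
  have h : Ideal.span {u} ⊔ idealOfVars (Fin n) ℂ = ⊤ := by
    obtain ⟨y, i, hi, h⟩ := (isMaximal_idealOfVars (σ := Fin n) (K := ℂ)).exists_inv
      (x := u) (by rwa [idealOfVars_eq_ker, RingHom.mem_ker])
    rw [Ideal.eq_top_iff_one, Ideal.mem_span_singleton_sup]
    exact ⟨y, i, hi, h⟩
  have h2 := Ideal.sup_pow_eq_top (n := N) h
  obtain ⟨a, b, hb, hab⟩ := Ideal.mem_span_singleton_sup.1 ((Ideal.eq_top_iff_one _).1 h2)
  exact ⟨a, by rw [← hab]; simpa using hb⟩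

/-- The regular function `(coordinate j) / (coordinate 0)` in the local ring at `P`. -/
def affineCoord (hB : B (Pi.single 0 1) = P.rep) (j : Fin n) : LocalRingAt P :=
  HomogeneousLocalization.mk ⟨1, ⟨coordForm B j.succ, isHomogeneous_coordForm B _⟩,
    ⟨coordForm B 0, isHomogeneous_coordForm B _⟩, coordForm_zero_notMem hB⟩

/-- The map from the affine coordinate ring to the local ring at `P`. -/
def toLocalRing (hB : B (Pi.single 0 1) = P.rep) : AffineRing n →+* LocalRingAt P :=
  eval₂Hom ((HomogeneousLocalization.fromZeroRingHom (grading n) (pointIdeal P).primeCompl).comp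
    (algebraMap ℂ (grading n 0))) (affineCoord hB)

theorem algebraMap_mk_mul {d : ℕ} {a g : CoordRing n} (ha : a ∈ grading n d) (hg : g ∈ grading n d)
    (hgP : g ∈ (pointIdeal P).primeCompl) :
    algebraMap (LocalRingAt P) (Localization.AtPrime (pointIdeal P))
      (HomogeneousLocalization.mk ⟨d, ⟨a, ha⟩, ⟨g, hg⟩, hgP⟩) *
      algebraMap (CoordRing n) (Localization.AtPrime (pointIdeal P)) g =
    algebraMap (CoordRing n) (Localization.AtPrime (pointIdeal P)) a := by
  rw [HomogeneousLocalization.algebraMap_apply, HomogeneousLocalization.val_mk,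
    Localization.mk_eq_mk']
  exact IsLocalization.mk'_spec (M := (pointIdeal P).primeCompl) _ a ⟨g, hgP⟩

theorem algebraMap_toLocalRing (hB : B (Pi.single 0 1) = P.rep) (s : AffineRing n) :
    algebraMap (LocalRingAt P) (Localization.AtPrime (pointIdeal P)) (toLocalRing hB s) =
      aeval (fun j => algebraMap (LocalRingAt P) (Localization.AtPrime (pointIdeal P))
        (affineCoord hB j)) s := by
  change ((algebraMap (LocalRingAt P) (Localization.AtPrime (pointIdeal P))).comp
    (toLocalRing hB)) s = (aeval _ : AffineRing n →ₐ[ℂ] _).toRingHom s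
  congr 1
  refine MvPolynomial.ringHom_ext (fun c => ?_) fun j => ?_
  · have h := algebraMap_mk_mul (P := P) (isHomogeneous_C (Fin (n + 1)) c)
      (isHomogeneous_one (Fin (n + 1)) ℂ) (one_mem _)
    rw [map_one, mul_one] at h
    simp only [toLocalRing, RingHom.comp_apply, coe_eval₂Hom, eval₂_C]
    refine h.trans ?_
    refine (IsScalarTower.algebraMap_apply ℂ (CoordRing n) _ c).symm.trans ?_
    exact (AlgHom.commutes (aeval (R := ℂ) fun j => algebraMap (LocalRingAt P)
      (Localization.AtPrime (pointIdeal P)) (affineCoord hB j)) c).symm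
  · simp [toLocalRing]

theorem algebraMap_toLocalRing_mul (hB : B (Pi.single 0 1) = P.rep) {s : AffineRing n} {d : ℕ}
    (hs : s.totalDegree ≤ d) :
    algebraMap (LocalRingAt P) (Localization.AtPrime (pointIdeal P)) (toLocalRing hB s) *
      algebraMap (CoordRing n) (Localization.AtPrime (pointIdeal P)) (coordForm B 0 ^ d) =
    algebraMap (CoordRing n) (Localization.AtPrime (pointIdeal P)) (homogenize B d s) := by
  have key : ∀ k, algebraMap (CoordRing n) (Localization.AtPrime (pointIdeal P))
      (cone B (homogeneousComponent k s)) =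
      algebraMap (CoordRing n) (Localization.AtPrime (pointIdeal P)) (coordForm B 0) ^ k *
      aeval (fun j => algebraMap (LocalRingAt P) (Localization.AtPrime (pointIdeal P))
        (affineCoord hB j)) (homogeneousComponent k s) := by
    intro k
    rw [← (homogeneousComponent_isHomogeneous k s).aeval_smul, cone]
    rw [← IsScalarTower.toAlgHom_apply ℂ, ← AlgHom.comp_apply, comp_aeval]
    congr 2
    ext j
    rw [Pi.smul_apply, smul_eq_mul, mul_comm]
    exact (algebraMap_mk_mul _ _ _).symm
  rw [algebraMap_toLocalRing, homogenize, map_sum]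
  conv_lhs => rw [← sum_range_homogeneousComponent hs, map_sum, Finset.sum_mul]
  refine Finset.sum_congr rfl fun k hk => ?_
  rw [map_mul, key, map_pow, map_pow]
  have : d = d - k + k := by have := Finset.mem_range.1 hk; omega
  conv_lhs => rw [this, pow_add]
  ring

theorem isUnit_algebraMap {g : CoordRing n} (hg : g ∉ pointIdeal P) :
    IsUnit (algebraMap (CoordRing n) (Localization.AtPrime (pointIdeal P)) g) :=
  IsLocalization.map_units (M := (pointIdeal P).primeCompl) _ ⟨g, hg⟩

theorem toLocalRing_mem_localIdeal_iff (hB : B (Pi.single 0 1) = P.rep) {I : Ideal (CoordRing n)}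
    (hI : I.IsHomogeneous (grading n)) {s : AffineRing n} :
    toLocalRing hB s ∈ localIdeal I P ↔
      ∃ u : AffineRing n, constantCoeff u ≠ 0 ∧ u * s ∈ I.map (dehom B) := by
  rw [localIdeal, Ideal.mem_comap, ← Ideal.mul_unit_mem_iff_mem _
    (isUnit_algebraMap ((pointIdeal P).primeCompl.pow_mem (coordForm_zero_notMem hB)
      s.totalDegree)),
    algebraMap_toLocalRing_mul hB le_rfl,
    algebraMap_mem_map_iff hB hI (isHomogeneous_homogenize B _ s), dehom_homogenize B le_rfl]

theorem mk_mem_localIdeal_iff (hB : B (Pi.single 0 1) = P.rep) {I : Ideal (CoordRing n)}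
    (hI : I.IsHomogeneous (grading n)) {d : ℕ} {a g : CoordRing n} (ha : a ∈ grading n d)
    (hg : g ∈ grading n d) (hgP : g ∈ (pointIdeal P).primeCompl) :
    HomogeneousLocalization.mk ⟨d, ⟨a, ha⟩, ⟨g, hg⟩, hgP⟩ ∈ localIdeal I P ↔
      ∃ u : AffineRing n, constantCoeff u ≠ 0 ∧ u * dehom B a ∈ I.map (dehom B) := by
  rw [localIdeal, Ideal.mem_comap, ← Ideal.mul_unit_mem_iff_mem _ (isUnit_algebraMap hgP),
    algebraMap_mk_mul, algebraMap_mem_map_iff hB hI ha]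

theorem localIdeal_le_of_map_le (hB : B (Pi.single 0 1) = P.rep) {I J : Ideal (CoordRing n)}
    (hI : I.IsHomogeneous (grading n)) (hJ : J.IsHomogeneous (grading n)) {u : AffineRing n}
    (hu : constantCoeff u ≠ 0) (h : ∀ s ∈ I.map (dehom B), u * s ∈ J.map (dehom B)) :
    localIdeal I P ≤ localIdeal J P := by
  intro x hx
  obtain ⟨⟨d, ⟨a, ha⟩, ⟨g, hg⟩, hgP⟩, rfl⟩ := HomogeneousLocalization.mk_surjective x
  obtain ⟨v, hv, hva⟩ := (mk_mem_localIdeal_iff hB hI ha hg hgP).1 hx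
  refine (mk_mem_localIdeal_iff hB hJ ha hg hgP).2 ⟨u * v, by simp [hu, hv], ?_⟩
  rw [mul_assoc]
  exact h _ hva

/-- The local ring of the subscheme at `P` is computed in the affine chart. -/
theorem length_localRingAt_quotient (hB : B (Pi.single 0 1) = P.rep) {I : Ideal (CoordRing n)}
    (hI : I.IsHomogeneous (grading n)) {𝔟 : Ideal (AffineRing n)} {N : ℕ}
    (hN : idealOfVars (Fin n) ℂ ^ N ≤ 𝔟) (hle : I.map (dehom B) ≤ 𝔟) {u : AffineRing n}
    (hu : constantCoeff u ≠ 0) (hu𝔟 : ∀ s ∈ 𝔟, u * s ∈ I.map (dehom B)) :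
    Module.length (LocalRingAt P) (LocalRingAt P ⧸ localIdeal I P) =
      Module.length (AffineRing n) (AffineRing n ⧸ 𝔟) := by
  -- The chart ring maps onto the local quotient with kernel `𝔟`. Both claims hold because a
  -- polynomial with nonzero constant term is invertible modulo `M ^ N`, hence modulo `𝔟`.
  let φ : AffineRing n →+* LocalRingAt P ⧸ localIdeal I P :=
    (Ideal.Quotient.mk _).comp (toLocalRing hB)
  have hker : ∀ s, φ s = 0 ↔ s ∈ 𝔟 := by
    intro s
    change Ideal.Quotient.mk _ (toLocalRing hB s) = 0 ↔ _
    rw [Ideal.Quotient.eq_zero_iff_mem, toLocalRing_mem_localIdeal_iff hB hI]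
    refine ⟨?_, fun hs => ⟨u, hu, hu𝔟 s hs⟩⟩
    rintro ⟨v, hv, hvs⟩
    obtain ⟨w, hw⟩ := exists_mul_sub_one_mem_pow hv N
    have := sub_mem (𝔟.mul_mem_left w (hle hvs)) (𝔟.mul_mem_right s (hN hw))
    convert this using 1
    ring
  have hsurj : Function.Surjective φ := by
    intro x
    obtain ⟨x, rfl⟩ := Ideal.Quotient.mk_surjective x
    obtain ⟨⟨d, ⟨a, ha⟩, ⟨g, hg⟩, hgP⟩, rfl⟩ := HomogeneousLocalization.mk_surjective x
    have hg0 := eval_ne_zero_of_notMem_pointIdeal hg hgP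
    rw [← constantCoeff_dehom hB] at hg0
    obtain ⟨w, hw⟩ := exists_mul_sub_one_mem_pow hg0 N
    -- Here `w` inverts the denominator modulo `M ^ N`, so `s` represents the fraction `a / g`.
    obtain ⟨s, hs⟩ : ∃ s, s = dehom B a * w := ⟨_, rfl⟩
    let D := s.totalDegree
    refine ⟨s, Ideal.Quotient.eq.2 ?_⟩
    rw [localIdeal, Ideal.mem_comap, ← Ideal.mul_unit_mem_iff_mem _
      (isUnit_algebraMap (P := P) (g := coordForm B 0 ^ D * g)
        ((pointIdeal P).primeCompl.mul_mem (pow_mem (coordForm_zero_notMem hB) D) hgP))]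
    have heq : algebraMap (LocalRingAt P) (Localization.AtPrime (pointIdeal P)) (toLocalRing hB s -
        HomogeneousLocalization.mk ⟨d, ⟨a, ha⟩, ⟨g, hg⟩, hgP⟩) *
        algebraMap (CoordRing n) (Localization.AtPrime (pointIdeal P)) (coordForm B 0 ^ D * g) =
        algebraMap (CoordRing n) (Localization.AtPrime (pointIdeal P))
          (homogenize B D s * g - coordForm B 0 ^ D * a) := by
      rw [map_sub, map_sub, map_mul, map_mul, map_mul, ← algebraMap_toLocalRing_mul hB le_rfl,
        ← algebraMap_mk_mul ha hg hgP]
      ring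
    rw [heq, algebraMap_mem_map_iff hB hI (d := D + d)]
    · refine ⟨u, hu, hu𝔟 _ ?_⟩
      rw [map_sub, map_mul, map_mul, map_pow, dehom_homogenize B le_rfl, dehom_coordForm_zero, hs]
      have := 𝔟.mul_mem_left (dehom B a) (hN hw)
      convert this using 1
      ring
    · exact ((isHomogeneous_homogenize B _ s).mul hg).sub
        ((isHomogeneous_coordForm_pow B 0 D).mul ha)
  have h1 := Module.length_eq_of_surjective (S := LocalRingAt P) (R := LocalRingAt P ⧸ localIdeal I P)
    (M := LocalRingAt P ⧸ localIdeal I P) Ideal.Quotient.mk_surjective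
  have h2 : RingHom.ker φ = 𝔟 := Ideal.ext hker
  rw [h1, ← length_quotient_ker hsurj, h2]

theorem localIdeal_eq_top {I : Ideal (CoordRing n)} {f : CoordRing n} (hf : f ∈ I)
    (hfP : eval P.rep f ≠ 0) : localIdeal I P = ⊤ := by
  rw [localIdeal, Ideal.eq_top_of_isUnit_mem _ (Ideal.mem_map_of_mem _ hf)
    (isUnit_algebraMap (notMem_pointIdeal_of_eval_ne_zero hfP)), Ideal.comap_top]

theorem length_eq_of_forall_ne {I : HomogeneousIdeal (grading n)}
    (h : ∀ Q ≠ P, ∃ f ∈ I, eval Q.rep f ≠ 0) :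
    length I = Module.length (LocalRingAt P) (LocalRingAt P ⧸ localIdeal I.toIdeal P) := by
  refine tsum_eq_single P fun Q hQ => ?_
  obtain ⟨f, hf, hfQ⟩ := h Q hQ
  rw [localIdeal_eq_top hf hfQ, Module.length_eq_zero_iff]
  exact Ideal.Quotient.subsingleton_iff.2 rfl

end Superfat

end

/-! ### Intersection with the lines through the point. -/

noncomputable section

namespace Superfat

variable {n : ℕ} {B : Frame n} {P : Point n}

/-- Restriction to the line through the origin with direction `v`. -/
def lineMap (v : Fin n → ℂ) : AffineRing n →ₐ[ℂ] Polynomial ℂ :=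
  aeval ((Polynomial.X : Polynomial ℂ) • fun j => Polynomial.C (v j))

theorem lineMap_of_isHomogeneous (v : Fin n → ℂ) {s : AffineRing n} {e : ℕ}
    (hs : s.IsHomogeneous e) :
    lineMap v s = Polynomial.X ^ e * Polynomial.C (eval v s) := by
  rw [lineMap, hs.aeval_smul]
  congr 1
  exact (MvPolynomial.aeval_algebraMap_apply (Polynomial ℂ) v s).trans (by rw [aeval_eq_eval]; rfl)

theorem coeff_lineMap (v : Fin n → ℂ) (s : AffineRing n) (k : ℕ) :
    (lineMap v s).coeff k = eval v (homogeneousComponent k s) := by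
  conv_lhs => rw [← sum_homogeneousComponent s, map_sum, Polynomial.finsetSum_coeff]
  simp only [lineMap_of_isHomogeneous v (homogeneousComponent_isHomogeneous _ s),
    Polynomial.coeff_X_pow_mul', Polynomial.coeff_C]
  by_cases hk : k ≤ s.totalDegree
  · rw [Finset.sum_eq_single_of_mem k (by simpa using hk)]
    · simp
    · intro e _ he
      split_ifs with h1 h2
      · omega
      · rfl
      · rfl
  · rw [homogeneousComponent_eq_zero k s (by omega), map_zero]
    refine Finset.sum_eq_zero fun e he => ?_
    have := Finset.mem_range.1 he
    rw [if_pos (by omega), if_neg (by omega)]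

theorem eval_lineMap (v : Fin n → ℂ) (s : AffineRing n) (t : ℂ) :
    (lineMap v s).eval t = eval (t • v) s := by
  rw [← Polynomial.coe_aeval_eq_eval, ← aeval_eq_eval, lineMap, ← AlgHom.comp_apply, comp_aeval]
  congr 2
  ext j
  simp only [Pi.smul_apply, smul_eq_mul, Polynomial.coe_aeval_eq_eval, Polynomial.eval_mul,
    Polynomial.eval_X, Polynomial.eval_C]

/-- A section of `lineMap v`. -/
theorem exists_lineMap_rightInverse {v : Fin n → ℂ} (hv : v ≠ 0) :
    ∃ σ : Polynomial ℂ →ₐ[ℂ] AffineRing n, ∀ p, lineMap v (σ p) = p := by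
  obtain ⟨j, hj⟩ := Function.ne_iff.1 hv
  refine ⟨Polynomial.aeval (C (v j)⁻¹ * X j), fun p => ?_⟩
  rw [← AlgHom.comp_apply]
  have : (lineMap v).comp (Polynomial.aeval (C (v j)⁻¹ * X j)) = AlgHom.id ℂ _ := by
    refine Polynomial.algHom_ext ?_
    have : Polynomial.C ((v j)⁻¹) * (Polynomial.X * Polynomial.C (v j)) = Polynomial.X := by
      rw [mul_comm Polynomial.X, ← mul_assoc, ← Polynomial.C_mul, inv_mul_cancel₀ hj,
        Polynomial.C_1, one_mul]
    simpa [lineMap, algebraMap_eq] using this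
  rw [this, AlgHom.id_apply]

theorem length_quotient_X_pow {K : Type*} [Field K] (k : ℕ) :
    Module.length (Polynomial K) (Polynomial K ⧸ Ideal.span {(Polynomial.X : Polynomial K) ^ k}) =
      k := by
  induction k with
  | zero =>
    rw [pow_zero, Ideal.span_singleton_one, Nat.cast_zero, Module.length_eq_zero_iff]
    exact Ideal.Quotient.subsingleton_iff.2 rfl
  | succ k ih =>
    rw [Ideal.length_quotient_eq_add (A := Ideal.span {(Polynomial.X : Polynomial K) ^ k})
      Polynomial.X, ih]
    · rw [sup_eq_right.2, Nat.cast_add, Nat.cast_one]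
      · congr 1
        rw [Module.length_eq_one_iff, isSimpleModule_iff_isCoatom]
        exact Ideal.isMaximal_def.1 (PrincipalIdealRing.isMaximal_of_irreducible
          Polynomial.irreducible_X)
      · rw [Ideal.span_singleton_le_span_singleton]
        exact dvd_pow_self _ (by omega)
    · intro g
      rw [Ideal.mem_span_singleton, Ideal.mem_span_singleton, pow_succ',
        mul_dvd_mul_iff_left Polynomial.X_ne_zero]

/-- The ideal of polynomials of order at least `k` along the line with direction `v`. -/
def lineIdeal (v : Fin n → ℂ) (k : ℕ) : Ideal (AffineRing n) :=
  (Ideal.span {(Polynomial.X : Polynomial ℂ) ^ k}).comap (lineMap v).toRingHom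

theorem mem_lineIdeal {v : Fin n → ℂ} {k : ℕ} {s : AffineRing n} :
    s ∈ lineIdeal v k ↔ ∀ e < k, eval v (homogeneousComponent e s) = 0 := by
  rw [lineIdeal, Ideal.mem_comap, Ideal.mem_span_singleton, Polynomial.X_pow_dvd_iff]
  simp only [← coeff_lineMap]
  rfl

theorem length_quotient_lineIdeal {v : Fin n → ℂ} (hv : v ≠ 0) (k : ℕ) :
    Module.length (AffineRing n) (AffineRing n ⧸ lineIdeal v k) = k := by
  obtain ⟨σ, hσ⟩ := exists_lineMap_rightInverse hv
  rw [lineIdeal, length_quotient_comap fun p => ⟨σ p, hσ p⟩, length_quotient_X_pow]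

variable (B) in
/-- The plane in `ℂⁿ⁺¹` of the line through the center of the chart with direction `v`. -/
def lineSpace (v : Fin n → ℂ) : Submodule ℂ (Fin (n + 1) → ℂ) :=
  Submodule.span ℂ {B (Fin.cons 1 0), B (Fin.cons 0 v)}

theorem smul_frame_cons_add (a b c d : ℂ) (v w : Fin n → ℂ) :
    a • B (Fin.cons c v) + b • B (Fin.cons d w) =
      B (Fin.cons (a * c + b * d) (a • v + b • w)) := by
  rw [← map_smul, ← map_smul, ← map_add]
  congr 1
  ext i
  refine Fin.cases ?_ (fun j => ?_) i <;> simp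

theorem mem_lineSpace {v : Fin n → ℂ} {w : Fin (n + 1) → ℂ} :
    w ∈ lineSpace B v ↔ ∃ a b : ℂ, B (Fin.cons a (b • v)) = w := by
  rw [lineSpace, Submodule.mem_span_pair]
  simp [smul_frame_cons_add]

theorem frame_cons_eq_zero {a : ℂ} {v : Fin n → ℂ} :
    B (Fin.cons a v) = 0 ↔ a = 0 ∧ v = 0 := by
  rw [LinearEquiv.map_eq_zero_iff]
  constructor
  · intro h
    exact ⟨by simpa using congrFun h 0, _root_.funext fun j => by simpa using congrFun h j.succ⟩
  · rintro ⟨rfl, rfl⟩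
    ext i
    refine Fin.cases ?_ (fun j => ?_) i <;> simp

theorem finrank_lineSpace {v : Fin n → ℂ} (hv : v ≠ 0) :
    Module.finrank ℂ (lineSpace B v) = 2 := by
  have h : LinearIndependent ℂ ![B (Fin.cons 1 0), B (Fin.cons 0 v)] := by
    rw [LinearIndependent.pair_iff]
    intro a b hab
    rw [smul_frame_cons_add, frame_cons_eq_zero] at hab
    refine ⟨by simpa using hab.1, ?_⟩
    simpa [hv] using hab.2
  have := finrank_span_eq_card h
  rwa [Matrix.range_cons_cons_empty, Fintype.card_fin] at this

theorem exists_notMem_of_finrank_eq_two {V : Type*} [AddCommGroup V] [Module ℂ V]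
    {W : Submodule ℂ V} (hW : Module.finrank ℂ W = 2) (p : V) : ∃ w ∈ W, ∀ a : ℂ, a • p ≠ w := by
  by_contra! h
  have hle : W ≤ Submodule.span ℂ {p} := fun w hw => Submodule.mem_span_singleton.2 (h w hw)
  have h1 := Submodule.finrank_mono hle
  have h2 := finrank_span_le_card (R := ℂ) ({p} : Set V)
  simp at h2
  omega

theorem exists_direction (w : Fin (n + 1) → ℂ) :
    ∃ (a : ℂ) (v : Fin n → ℂ), w = B (Fin.cons a v) :=
  ⟨B.symm w 0, fun j => B.symm w j.succ, by
    rw [← B.symm_apply_eq]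
    ext i
    refine Fin.cases ?_ (fun j => ?_) i <;> simp⟩

theorem exists_eq_lineSpace {W : Submodule ℂ (Fin (n + 1) → ℂ)} (hW : Module.finrank ℂ W = 2)
    (hP : B (Fin.cons 1 0) ∈ W) : ∃ v, v ≠ 0 ∧ W = lineSpace B v := by
  obtain ⟨w, hw, hwP⟩ := exists_notMem_of_finrank_eq_two hW (B (Fin.cons 1 0))
  obtain ⟨a, v, rfl⟩ := exists_direction (B := B) w
  have hv : v ≠ 0 := by
    rintro rfl
    exact hwP a (by simpa using smul_frame_cons_add (B := B) a 0 1 0 0 0)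
  refine ⟨v, hv, (Submodule.eq_of_le_of_finrank_eq (Submodule.span_le.2 ?_) ?_).symm⟩
  · rintro _ (rfl | rfl)
    · exact hP
    · have h : B (Fin.cons 0 v) = (1 : ℂ) • B (Fin.cons a v) + (-a) • B (Fin.cons 1 0) := by
        rw [smul_frame_cons_add]
        simp
      rw [SetLike.mem_coe, h]
      exact W.add_mem (W.smul_mem _ hw) (W.smul_mem _ hP)
  · exact (finrank_lineSpace hv).trans hW.symm

theorem mem_map_linearIdeal_of_lineMap_eq_zero {v : Fin n → ℂ} {s : AffineRing n}
    (hs : lineMap v s = 0) : s ∈ (linearIdeal (lineSpace B v)).toIdeal.map (dehom B) := by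
  -- The homogenization vanishes on the affine part of the line; the factor `coordForm B 0` takes
  -- care of its point at infinity and becomes `1` on the chart.
  have : coordForm B 0 * homogenize B s.totalDegree s ∈
      (linearIdeal (lineSpace B v)).toIdeal := by
    change _ ∈ vanishingIdeal ℂ _
    rw [mem_vanishingIdeal_iff]
    intro w hw
    obtain ⟨a, b, rfl⟩ := mem_lineSpace.1 hw
    rw [aeval_eq_eval, map_mul, eval_coordForm, B.symm_apply_apply, Fin.cons_zero]
    by_cases ha : a = 0
    · rw [ha, zero_mul]
    · have : B (Fin.cons a (b • v)) = a • B (Fin.cons 1 ((a⁻¹ * b) • v)) := by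
        simpa [smul_smul, ha] using (smul_frame_cons_add (B := B) a 0 1 0 ((a⁻¹ * b) • v) 0).symm
      rw [this, (isHomogeneous_homogenize B _ s).eval_smul, ← eval_dehom,
        dehom_homogenize B le_rfl, ← eval_lineMap, hs, Polynomial.eval_zero, mul_zero, mul_zero]
  have h := Ideal.mem_map_of_mem (dehom B) this
  rwa [map_mul, dehom_coordForm_zero, one_mul, dehom_homogenize B le_rfl] at h

theorem lineMap_dehom_eq_zero {v : Fin n → ℂ} {f : CoordRing n}
    (hf : f ∈ linearIdeal (lineSpace B v)) : lineMap v (dehom B f) = 0 := by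
  refine Polynomial.funext fun t => ?_
  rw [eval_lineMap, eval_dehom, Polynomial.eval_zero, ← aeval_eq_eval]
  exact (mem_vanishingIdeal_iff).1 hf _ (mem_lineSpace.2 ⟨1, t, rfl⟩)

/-- The intersection number with a line through `P` is the minimal order along this line. -/
theorem length_sup_linearIdeal (hB : B (Pi.single 0 1) = P.rep) {I : HomogeneousIdeal (grading n)}
    (hI : ∀ Q ≠ P, ∃ f ∈ I, eval Q.rep f ≠ 0) {v : Fin n → ℂ} (hv : v ≠ 0) {k : ℕ}
    (hle : I.toIdeal.map (dehom B) ≤ lineIdeal v k)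
    (hne : ∃ s ∈ I.toIdeal.map (dehom B), eval v (homogeneousComponent k s) ≠ 0) :
    length (I ⊔ linearIdeal (lineSpace B v)) = k := by
  rw [length_eq_of_forall_ne (P := P) fun Q hQ => by
    obtain ⟨f, hf, hfQ⟩ := hI Q hQ
    exact ⟨f, (le_sup_left : I ≤ I ⊔ _) hf, hfQ⟩]
  obtain ⟨σ, hσ⟩ := exists_lineMap_rightInverse hv
  obtain ⟨s₀, hs₀, hs₀k⟩ := hne
  have hdvd : ∀ s ∈ lineIdeal v k, ∃ p, lineMap v s = Polynomial.X ^ k * p := fun s hs =>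
    Ideal.mem_span_singleton.1 hs
  obtain ⟨q, hq⟩ := hdvd s₀ (hle hs₀)
  have hq0 : q.coeff 0 ≠ 0 := by
    rw [← coeff_lineMap, hq] at hs₀k
    simpa [Polynomial.coeff_X_pow_mul'] using hs₀k
  have hmap : (I ⊔ linearIdeal (lineSpace B v)).toIdeal.map (dehom B) =
      I.toIdeal.map (dehom B) ⊔ (linearIdeal (lineSpace B v)).toIdeal.map (dehom B) := by
    rw [HomogeneousIdeal.toIdeal_sup, Ideal.map_sup]
  -- The restriction of `s₀` to the line is `X ^ k * q` with `q` a unit at the origin. The lift `σ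
  -- q` is thus the local unit that brings all of `lineIdeal v k` into the ideal of the
  -- intersection.
  rw [length_localRingAt_quotient hB (HomogeneousIdeal.isHomogeneous _) (𝔟 := lineIdeal v k)
    (N := k) (u := σ q), length_quotient_lineIdeal hv]
  · intro s hs
    rw [mem_lineIdeal]
    intro e he
    rw [mem_pow_idealOfVars_iff_homogeneousComponent.1 hs e he, map_zero]
  · rw [hmap, sup_le_iff]
    refine ⟨hle, Ideal.map_le_iff_le_comap.2 fun f hf => ?_⟩
    rw [Ideal.mem_comap, mem_lineIdeal]
    intro e _
    rw [← coeff_lineMap, lineMap_dehom_eq_zero hf, Polynomial.coeff_zero]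
  · have : (lineMap v (σ q)).coeff 0 = q.coeff 0 := by rw [hσ]
    rw [coeff_lineMap, homogeneousComponent_zero, eval_C] at this
    rwa [constantCoeff_eq, this]
  · intro s hs
    obtain ⟨p, hp⟩ := hdvd s hs
    rw [hmap]
    have h1 : σ q * s - σ p * s₀ ∈ (linearIdeal (lineSpace B v)).toIdeal.map (dehom B) := by
      refine mem_map_linearIdeal_of_lineMap_eq_zero ?_
      rw [map_sub, map_mul, map_mul, hσ, hσ, hp, hq]
      ring
    have := add_mem (Ideal.mem_sup_right h1) (Ideal.mem_sup_left (Ideal.mul_mem_left _ (σ p) hs₀))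
    rwa [sub_add_cancel] at this

end Superfat

end

/-! ### Symmetric schemes in a chart, and closures of affine schemes. -/

noncomputable section

namespace Superfat

variable {n m : ℕ} {B : Frame n} {P : Point n}

theorem eval_smul_eq_zero {I : Ideal (CoordRing n)} (hI : I.IsHomogeneous (grading n))
    {w : Fin (n + 1) → ℂ} (hw : ∀ f ∈ I, eval w f = 0) (c : ℂ) : ∀ f ∈ I, eval (c • w) f = 0 := by
  intro f hf
  rw [← sum_homogeneousComponent f, map_sum]
  refine Finset.sum_eq_zero fun k _ => ?_
  rw [(homogeneousComponent_isHomogeneous k f).eval_smul,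
    hw _ (homogeneousComponent_mem_of_mem hI hf k), mul_zero]

theorem mk_mem_support {Y : ClosedSubscheme n} {w : Fin (n + 1) → ℂ} (hw0 : w ≠ 0)
    (hw : ∀ f ∈ Y.ideal, eval w f = 0) : Projectivization.mk ℂ w hw0 ∈ Y.support := by
  obtain ⟨a, ha⟩ := Projectivization.exists_smul_eq_mk_rep ℂ w hw0
  intro f hf
  rw [← ha]
  exact eval_smul_eq_zero Y.ideal.isHomogeneous hw a f hf

theorem exists_eval_ne_zero_of_support_eq {Y : ClosedSubscheme n} (hY : Y.support = {P})
    {Q : Point n} (hQ : Q ≠ P) : ∃ f ∈ Y.ideal, eval Q.rep f ≠ 0 := by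
  have : Q ∉ Y.support := by rwa [hY]
  simpa [ClosedSubscheme.support] using this

theorem exists_smul_rep_of_support_eq {Y : ClosedSubscheme n} (hY : Y.support = {P})
    {w : Fin (n + 1) → ℂ} (hw0 : w ≠ 0) (hw : ∀ f ∈ Y.ideal, eval w f = 0) :
    ∃ c : ℂ, c ≠ 0 ∧ w = c • P.rep := by
  have h := mk_mem_support hw0 hw
  rw [hY, Set.mem_singleton_iff] at h
  obtain ⟨a, ha⟩ := Projectivization.exists_smul_eq_mk_rep ℂ w hw0
  rw [h] at ha
  exact ⟨(a⁻¹ : ℂˣ), a⁻¹.ne_zero, by rw [← ha]; simp [Units.smul_def, smul_smul]⟩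

theorem length_eq_of_support_eq {Y : ClosedSubscheme n} (hY : Y.support = {P}) :
    length Y.ideal = Module.length (LocalRingAt P) (LocalRingAt P ⧸ localIdeal Y.ideal.toIdeal P) :=
  length_eq_of_forall_ne fun _ hQ => exists_eval_ne_zero_of_support_eq hY hQ

/-- A closed subscheme supported at `P` is determined by its ideal in the local ring at `P`. -/
theorem mem_ideal_of_support_eq (hB : B (Pi.single 0 1) = P.rep) {Y : ClosedSubscheme n}
    (hY : Y.support = {P}) {f : CoordRing n} {d : ℕ} (hf : f.IsHomogeneous d) {u : AffineRing n}
    (hu : constantCoeff u ≠ 0) (huf : u * dehom B f ∈ Y.ideal.toIdeal.map (dehom B)) :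
    f ∈ Y.ideal := by
  obtain ⟨e, g, hge, hg, hgf⟩ := exists_isHomogeneous_mul_mem hB Y.ideal.isHomogeneous hf hu huf
  -- The colon ideal of `f`. Its zeros lie on the line of `P` because it contains the ideal of `Y`,
  -- but `g` belongs to it and is nonzero at `P`. Hence only the origin is left, the Nullstellensatz
  -- gives powers of all variables in `J`, and saturation applies.
  let J : Ideal (CoordRing n) := Submodule.comap (LinearMap.mulRight (CoordRing n) f) Y.ideal.toIdeal
  have hJ : ∀ i, X i ∈ J.radical := by
    intro i
    rw [← vanishingIdeal_zeroLocus_eq_radical (K := ℂ), mem_vanishingIdeal_iff]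
    intro w hw
    by_cases hw0 : w = 0
    · simp [hw0]
    · exfalso
      obtain ⟨c, hc, hcw⟩ := exists_smul_rep_of_support_eq hY hw0 fun h hh => by
        rw [← aeval_eq_eval]
        exact hw h (Y.ideal.toIdeal.mul_mem_right f hh)
      have := hw g hgf
      rw [aeval_eq_eval, hcw, hge.eval_smul] at this
      exact mul_ne_zero (pow_ne_zero _ hc) hg this
  exact Y.saturated f fun i => hJ i

/-- The least order along each line through `P` equals the length of the intersection, namely `m`.
Components of degree below `m` therefore vanish in every direction, hence identically. -/
theorem le_pow_and_exists_of_isSymmetric {Y : ClosedSubscheme n} (hB : B (Pi.single 0 1) = P.rep)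
    (hY : Y.support = {P}) (hm : ∀ W : Submodule ℂ (Fin (n + 1) → ℂ), Module.finrank ℂ W = 2 →
      P.submodule ≤ W → length (Y.ideal ⊔ linearIdeal W) = m) :
    Y.ideal.toIdeal.map (dehom B) ≤ idealOfVars (Fin n) ℂ ^ m ∧
      ∀ v : Fin n → ℂ, v ≠ 0 → ∃ s ∈ Y.ideal.toIdeal.map (dehom B),
        eval v (homogeneousComponent m s) ≠ 0 := by
  have key : ∀ v : Fin n → ℂ, v ≠ 0 → Y.ideal.toIdeal.map (dehom B) ≤ lineIdeal v m ∧
      ∃ s ∈ Y.ideal.toIdeal.map (dehom B), eval v (homogeneousComponent m s) ≠ 0 := by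
    intro v hv
    have hex : ∃ k, ∃ s ∈ Y.ideal.toIdeal.map (dehom B), eval v (homogeneousComponent k s) ≠ 0 := by
      -- If every order along the direction `v` vanished, the point at `v` of this line would be a
      -- second point of the support.
      by_contra! h
      obtain ⟨c, hc, hcw⟩ := exists_smul_rep_of_support_eq hY (w := B (Fin.cons 1 v))
        (fun h => one_ne_zero (frame_cons_eq_zero.1 h).1) fun f hf => by
          have : lineMap v (dehom B f) = 0 := Polynomial.ext fun k => by
            rw [coeff_lineMap, h k _ (Ideal.mem_map_of_mem _ hf), Polynomial.coeff_zero]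
          rw [← eval_dehom, ← one_smul ℂ v, ← eval_lineMap, this, Polynomial.eval_zero]
      rw [← frame_cons_zero hB, ← map_smul, B.injective.eq_iff] at hcw
      exact hv (_root_.funext fun j => by simpa using congrFun hcw j.succ)
    classical
    have hle : Y.ideal.toIdeal.map (dehom B) ≤ lineIdeal v (Nat.find hex) := by
      intro s hs
      rw [mem_lineIdeal]
      intro e he
      by_contra h
      exact Nat.find_min hex he ⟨s, hs, h⟩
    have h1 := length_sup_linearIdeal hB (fun Q hQ => exists_eval_ne_zero_of_support_eq hY hQ) hv
      hle (Nat.find_spec hex)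
    rw [hm _ (finrank_lineSpace hv)] at h1
    · have h2 : m = Nat.find hex := by exact_mod_cast h1
      rw [h2]
      exact ⟨hle, Nat.find_spec hex⟩
    · rw [Projectivization.submodule_eq, Submodule.span_singleton_le_iff_mem, ← frame_cons_zero hB]
      exact Submodule.subset_span (by simp)
  refine ⟨fun s hs => ?_, fun v hv => (key v hv).2⟩
  rw [mem_pow_idealOfVars_iff_homogeneousComponent]
  intro e he
  refine MvPolynomial.funext fun v => ?_
  rw [map_zero]
  -- The origin is not a direction: there the constant term vanishes because `P` lies on `Y`, and
  -- forms of positive degree vanish anyway.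
  by_cases hv : v = 0
  · rcases Nat.eq_zero_or_pos e with rfl | he0
    · obtain ⟨f, hf, rfl⟩ := (Ideal.mem_map_iff_of_surjective _ (dehom_surjective B)).1 hs
      rw [homogeneousComponent_zero, eval_C, ← constantCoeff_eq, constantCoeff_dehom hB]
      have : P ∈ Y.support := by rw [hY]; rfl
      exact this f hf
    · rw [hv, ← zero_smul ℂ (0 : Fin n → ℂ),
        (homogeneousComponent_isHomogeneous e s).eval_smul, zero_pow he0.ne', zero_mul]
  · exact mem_lineIdeal.1 ((key v hv).1 hs) e he

theorem isSymmetric_of_le_pow {Y : ClosedSubscheme n} (hB : B (Pi.single 0 1) = P.rep)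
    (hY : Y.support = {P}) (h1 : Y.ideal.toIdeal.map (dehom B) ≤ idealOfVars (Fin n) ℂ ^ m)
    (h2 : ∀ v : Fin n → ℂ, v ≠ 0 → ∃ s ∈ Y.ideal.toIdeal.map (dehom B),
        eval v (homogeneousComponent m s) ≠ 0) : IsSymmetric m Y := by
  refine ⟨P, hY, fun W hW hPW => ?_⟩
  obtain ⟨v, hv, rfl⟩ := exists_eq_lineSpace (B := B) hW (by
    rw [frame_cons_zero hB]
    exact hPW (by rw [Projectivization.submodule_eq]; exact Submodule.mem_span_singleton_self _))
  refine length_sup_linearIdeal hB (fun Q hQ => exists_eval_ne_zero_of_support_eq hY hQ) hv ?_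
    (h2 v hv)
  intro s hs
  rw [mem_lineIdeal]
  intro e he
  rw [mem_pow_idealOfVars_iff_homogeneousComponent.1 (h1 hs) e he, map_zero]

section Closure

variable (B) (𝔞 : Ideal (AffineRing n))

/-- The ideal generated by the homogeneous polynomials that restrict to elements of `𝔞` on the
affine chart. -/
def closureIdeal : HomogeneousIdeal (grading n) := (𝔞.comap (dehom B)).homogeneousCore (grading n)

variable {B 𝔞}

theorem mem_closureIdeal_of_isHomogeneous {f : CoordRing n} {d : ℕ} (hf : f.IsHomogeneous d) :
    f ∈ closureIdeal B 𝔞 ↔ dehom B f ∈ 𝔞 :=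
  ⟨fun h => Ideal.toIdeal_homogeneousCore_le (grading n) (𝔞.comap (dehom B)) h,
    fun h => Ideal.mem_homogeneousCore_of_homogeneous_of_mem ⟨d, hf⟩ h⟩

theorem mem_closureIdeal {f : CoordRing n} :
    f ∈ closureIdeal B 𝔞 ↔ ∀ d, dehom B (homogeneousComponent d f) ∈ 𝔞 := by
  rw [← HomogeneousIdeal.mem_iff,
    mem_iff_homogeneousComponent_mem (closureIdeal B 𝔞).isHomogeneous f]
  exact forall_congr' fun d =>
    mem_closureIdeal_of_isHomogeneous (homogeneousComponent_isHomogeneous d f)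

theorem map_closureIdeal : (closureIdeal B 𝔞).toIdeal.map (dehom B) = 𝔞 := by
  refine le_antisymm (Ideal.map_le_iff_le_comap.2 (Ideal.toIdeal_homogeneousCore_le _ _)) ?_
  intro s hs
  have h : dehom B (homogenize B s.totalDegree s) = s := dehom_homogenize B le_rfl
  rw [← h]
  refine Ideal.mem_map_of_mem _ ?_
  rw [HomogeneousIdeal.mem_iff,
    mem_closureIdeal_of_isHomogeneous (isHomogeneous_homogenize B _ s), h]
  exact hs

variable (B 𝔞) in
/-- The closure in `ℙⁿ` of a closed subscheme of the affine chart. -/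
def closureScheme : ClosedSubscheme n where
  ideal := closureIdeal B 𝔞
  saturated f hf := by
    rw [mem_closureIdeal]
    intro d
    let J : Ideal (AffineRing n) :=
      Submodule.comap (LinearMap.mulRight (AffineRing n) (dehom B (homogeneousComponent d f))) 𝔞
    have hX : ∀ i, dehom B (X i) ∈ J.radical := by
      intro i
      obtain ⟨k, hk⟩ := hf i
      refine ⟨k, ?_⟩
      have := mem_closureIdeal.1 hk (k + d)
      rwa [mul_comm, homogeneousComponent_mul_of_isHomogeneous (isHomogeneous_X_pow i k) (by omega),
        Nat.add_sub_cancel_left, map_mul, map_pow, mul_comm] at this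
    -- The form at infinity is a combination of the variables and restricts to `1`, so the
    -- restricted variables generate the unit ideal.
    have h1 : (1 : AffineRing n) ∈ J.radical := by
      rw [← dehom_coordForm_zero B, coordForm, map_sum]
      refine sum_mem fun i _ => ?_
      rw [map_mul]
      exact Ideal.mul_mem_left _ _ (hX i)
    obtain ⟨k, hk⟩ := h1
    rw [one_pow] at hk
    simpa [J] using hk

theorem support_closureScheme (hB : B (Pi.single 0 1) = P.rep) {N : ℕ}
    (hN : idealOfVars (Fin n) ℂ ^ N ≤ 𝔞) (h𝔞 : 𝔞 ≤ idealOfVars (Fin n) ℂ) :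
    (closureScheme B 𝔞).support = {P} := by
  ext Q
  rw [Set.mem_singleton_iff]
  constructor
  · intro hQ
    obtain ⟨a, v, hav⟩ := exists_direction (B := B) Q.rep
    have hv : v = 0 := by
      ext j
      have h : coordForm B j.succ ^ N ∈ closureIdeal B 𝔞 := by
        rw [mem_closureIdeal_of_isHomogeneous (isHomogeneous_coordForm_pow B _ _), map_pow]
        refine hN (Ideal.pow_mem_pow ?_ N)
        have : dehom B (coordForm B j.succ) = X j :=
          MvPolynomial.funext fun z => by simp [eval_dehom, eval_coordForm]
        rw [this]
        exact Ideal.subset_span ⟨j, rfl⟩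
      have h2 := hQ _ h
      rw [map_pow, eval_coordForm, hav, B.symm_apply_apply, Fin.cons_succ] at h2
      exact eq_zero_of_pow_eq_zero h2
    have h3 : Q.rep = a • P.rep := by
      rw [hav, hv, ← frame_cons_zero hB]
      simpa using (smul_frame_cons_add (B := B) a 0 1 0 0 0).symm
    rw [← Q.mk_rep, ← P.mk_rep, Projectivization.mk_eq_mk_iff']
    exact ⟨a, h3.symm⟩
  · rintro rfl f hf
    have hf := mem_closureIdeal.1 hf
    rw [← sum_homogeneousComponent f, map_sum]
    refine Finset.sum_eq_zero fun k _ => ?_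
    have h1 := h𝔞 (hf k)
    rwa [idealOfVars_eq_ker, RingHom.mem_ker, constantCoeff_dehom hB] at h1

theorem length_closureScheme (hB : B (Pi.single 0 1) = P.rep) {N : ℕ}
    (hN : idealOfVars (Fin n) ℂ ^ N ≤ 𝔞) (h𝔞 : 𝔞 ≤ idealOfVars (Fin n) ℂ) :
    length (closureScheme B 𝔞).ideal = Module.length (AffineRing n) (AffineRing n ⧸ 𝔞) := by
  rw [length_eq_of_support_eq (support_closureScheme hB hN h𝔞)]
  refine length_localRingAt_quotient hB (HomogeneousIdeal.isHomogeneous _) hN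
    map_closureIdeal.le (u := 1) (by simp) fun s hs => ?_
  rw [one_mul]
  exact map_closureIdeal.ge hs

end Closure

end Superfat

end

/-! ### Tangent cones, and the complete intersection containing a symmetric scheme. -/

noncomputable section

namespace Superfat

variable {n m : ℕ} {B : Frame n} {P : Point n}

theorem translate_coordForm_zero (hB : B (Pi.single 0 1) = P.rep) :
    aeval (fun i => C (P.rep i) + X i) (coordForm B 0) = 1 + coordForm B 0 := by
  refine MvPolynomial.funext fun w => ?_
  rw [← aeval_eq_eval, ← AlgHom.comp_apply, comp_aeval, aeval_eq_eval, map_add, map_one,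
    aeval_eq_eval, eval_coordForm, eval_coordForm]
  have : (fun i => eval w (C (P.rep i) + X i : CoordRing n)) = P.rep + w := by
    ext i
    simp
  rw [this, map_add, ← hB, B.symm_apply_apply]
  simp

theorem translate_cone (hB : B (Pi.single 0 1) = P.rep) (s : AffineRing n) :
    aeval (fun i => C (P.rep i) + X i) (cone B s) = cone B s := by
  refine MvPolynomial.funext fun w => ?_
  rw [← aeval_eq_eval, ← AlgHom.comp_apply, comp_aeval, aeval_eq_eval, aeval_eq_eval, eval_cone,
    eval_cone]
  have : (fun i => eval w (C (P.rep i) + X i : CoordRing n)) = P.rep + w := by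
    ext i
    simp
  rw [this, map_add, ← hB, B.symm_apply_apply]
  simp

/-- The leading Taylor term at `P` of a hypersurface given on the affine chart by a polynomial
`s` of order at least `m` is the form of degree `m` of `s`. -/
theorem taylorPart_homogenize (hB : B (Pi.single 0 1) = P.rep) {s : AffineRing n}
    (hs : s ∈ idealOfVars (Fin n) ℂ ^ m) {d : ℕ} (hm : m ≤ d) {e : ℕ} (he : e ≤ m) :
    taylorPart (homogenize B d s) P e = if e = m then cone B (homogeneousComponent m s) else 0 := by
  set c := cone B (homogeneousComponent m s) with hc
  have hcm : c.IsHomogeneous m := isHomogeneous_cone B (homogeneousComponent_isHomogeneous m s)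
  have key : aeval (fun i => C (P.rep i) + X i) (homogenize B d s) - c ∈
      idealOfVars (Fin (n + 1)) ℂ ^ (m + 1) := by
    have h1 : c = ∑ k ∈ Finset.range (d + 1), if k = m then c else 0 := by
      rw [Finset.sum_ite_eq' (Finset.range (d + 1)) m, if_pos (Finset.mem_range.2 (by omega))]
    rw [h1, homogenize, map_sum, ← Finset.sum_sub_distrib]
    refine sum_mem fun k _ => ?_
    rw [map_mul, map_pow, translate_coordForm_zero hB, translate_cone hB]
    rcases lt_trichotomy k m with hk | rfl | hk
    · rw [mem_pow_idealOfVars_iff_homogeneousComponent.1 hs k hk, if_neg hk.ne]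
      simp
    · rw [if_pos rfl, ← hc, ← sub_one_mul, pow_succ']
      refine Ideal.mul_mem_mul ?_ hcm.mem_pow_idealOfVars
      rw [idealOfVars_eq_ker, RingHom.mem_ker, map_sub, map_pow, map_add, map_one]
      have : constantCoeff (coordForm B 0) = 0 := by
        rw [← RingHom.mem_ker, ← idealOfVars_eq_ker, ← pow_one (idealOfVars _ ℂ)]
        exact (isHomogeneous_coordForm B 0).mem_pow_idealOfVars
      rw [this, add_zero, one_pow, sub_self]
    · rw [if_neg hk.ne', sub_zero]
      exact Ideal.mul_mem_left _ _ (Ideal.pow_le_pow_right hk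
        (isHomogeneous_cone B (homogeneousComponent_isHomogeneous k s)).mem_pow_idealOfVars)
  have h2 := mem_pow_idealOfVars_iff_homogeneousComponent.1 key e (by omega)
  rw [map_sub, sub_eq_zero] at h2
  rw [taylorPart, h2]
  exact homogeneousComponent_of_mem hcm

/-- Nakayama's lemma before localizing: the unit of the local ring appears as a polynomial `u`
congruent to `1` modulo the ideal of the origin. -/
theorem exists_mul_pow_le {𝔤 : Ideal (AffineRing n)} {r : ℕ}
    (h : idealOfVars (Fin n) ℂ ^ r ≤ 𝔤 ⊔ idealOfVars (Fin n) ℂ ^ (r + 1)) :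
    ∃ u : AffineRing n, constantCoeff u ≠ 0 ∧ ∀ s ∈ idealOfVars (Fin n) ℂ ^ r, u * s ∈ 𝔤 := by
  obtain ⟨u, hu, hu2⟩ := Submodule.exists_sub_one_mem_and_smul_le_of_fg_of_le_sup
    (I := idealOfVars (Fin n) ℂ) (N := 𝔤) (IsNoetherian.noetherian (idealOfVars (Fin n) ℂ ^ r))
    le_rfl (by rwa [smul_eq_mul, ← pow_succ'])
  refine ⟨u, ?_, fun s hs => hu2 (Submodule.smul_mem_pointwise_smul s u _ hs)⟩
  rw [idealOfVars_eq_ker, RingHom.mem_ker, map_sub, map_one, sub_eq_zero] at hu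
  rw [hu]
  exact one_ne_zero

/-- Every `m`-symmetric scheme is contained in an `m`-symmetric scheme of length `m ^ n` that is
locally a complete intersection of `n` hypersurfaces of multiplicity `m`. -/
theorem exists_le_complete_intersection (hm : 1 ≤ m) {Y : ClosedSubscheme n}
    (hY : IsSymmetric m Y) : ∃ (P : Point n) (Z : ClosedSubscheme n), Y.support = {P} ∧
      Z.support = {P} ∧ Y ≤ Z ∧ IsSymmetric m Z ∧ length Z.ideal = (m : ℕ∞) ^ n ∧
      ∃ (G : Fin n → CoordRing n) (d : Fin n → ℕ), (∀ i, (G i).IsHomogeneous (d i)) ∧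
        (∀ i, HasMultiplicity (G i) P m) ∧
        (∀ W : Submodule ℂ (Fin (n + 1) → ℂ), Module.finrank ℂ W = 2 →
          ∃ i, ∃ w ∈ W, eval w (taylorPart (G i) P m) ≠ 0) ∧
        localIdeal Z.ideal.toIdeal P = localIdeal (Ideal.span (Set.range G)) P := by
  obtain ⟨P, hYP, hYL⟩ := hY
  obtain ⟨B, hB⟩ := exists_frame P
  obtain ⟨h1, h2⟩ := le_pow_and_exists_of_isSymmetric hB hYP hYL
  obtain ⟨g, hg𝔞, hg0, hgz, r, hr⟩ := exists_complete_intersection hm h1 h2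
  have hgm : ∀ i, g i ∈ idealOfVars (Fin n) ℂ ^ m := fun i => h1 (hg𝔞 i)
  -- The bound `r` makes the length computation valid, and the bound `m` keeps the truncated ideal
  -- `𝔟` inside `M ^ m`.
  let N := max r m
  let 𝔟 : Ideal (AffineRing n) := Ideal.span (Set.range g) ⊔ idealOfVars (Fin n) ℂ ^ N
  have hN𝔟 : idealOfVars (Fin n) ℂ ^ N ≤ 𝔟 := le_sup_right
  have h𝔟m : 𝔟 ≤ idealOfVars (Fin n) ℂ ^ m := by
    refine sup_le (Ideal.span_le.2 ?_) (Ideal.pow_le_pow_right (le_max_right _ _))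
    rintro _ ⟨i, rfl⟩
    exact hgm i
  have h𝔟 : 𝔟 ≤ idealOfVars (Fin n) ℂ := h𝔟m.trans (Ideal.pow_le_self (by omega))
  have hg2 : ∀ v : Fin n → ℂ, v ≠ 0 → ∃ i, eval v (homogeneousComponent m (g i)) ≠ 0 := by
    intro v hv
    by_contra! h
    exact hv (hgz v h)
  obtain ⟨u, hu, huN⟩ : ∃ u : AffineRing n, constantCoeff u ≠ 0 ∧
      ∀ s ∈ idealOfVars (Fin n) ℂ ^ N, u * s ∈ Ideal.span (Set.range g) :=
    exists_mul_pow_le ((Ideal.pow_le_pow_right (le_max_left _ _)).trans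
      (hr (N + 1) ((le_max_left r m).trans (Nat.le_succ _))).1)
  have hu𝔟 : ∀ s ∈ 𝔟, u * s ∈ Ideal.span (Set.range g) := by
    intro s hs
    obtain ⟨a, ha, b, hb, rfl⟩ := Submodule.mem_sup.1 hs
    rw [mul_add]
    exact add_mem (Ideal.mul_mem_left _ _ ha) (huN b hb)
  -- The degree must reach the total degree for `dehom` to recover `g i`, and must be at least `m`
  -- for `taylorPart_homogenize`.
  let d : Fin n → ℕ := fun i => max m (g i).totalDegree
  let G : Fin n → CoordRing n := fun i => homogenize B (d i) (g i)
  have hG : ∀ i, dehom B (G i) = g i := fun i => dehom_homogenize B (le_max_right _ _)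
  have hGd : ∀ i, (G i).IsHomogeneous (d i) := fun i => isHomogeneous_homogenize B _ _
  have hspan : (Ideal.span (Set.range G)).map (dehom B) = Ideal.span (Set.range g) := by
    rw [Ideal.map_span, ← Set.range_comp]
    congr 2
    exact _root_.funext hG
  have hspanH : (Ideal.span (Set.range G)).IsHomogeneous (grading n) :=
    Ideal.homogeneous_span _ _ (by rintro _ ⟨i, rfl⟩; exact ⟨d i, hGd i⟩)
  have hsupp := support_closureScheme hB hN𝔟 h𝔟
  refine ⟨P, closureScheme B 𝔟, hYP, hsupp, ?_, ?_, ?_, G, d, hGd, fun i => ⟨fun k hk => ?_, ?_⟩,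
    fun W hW => ?_, le_antisymm ?_ ?_⟩
  · intro f hf
    rw [← sum_homogeneousComponent f]
    refine sum_mem fun k _ => ?_
    -- Locally at `P` the ideal of `Z` is generated by the `g i`, which lie in the ideal of `Y`; as
    -- `Y` is supported only at `P`, this local inclusion suffices.
    refine mem_ideal_of_support_eq hB hYP (homogeneousComponent_isHomogeneous k f) hu ?_
    refine Ideal.span_le.2 ?_ (hu𝔟 _ (mem_closureIdeal.1 hf k))
    rintro _ ⟨i, rfl⟩
    exact hg𝔞 i
  · refine isSymmetric_of_le_pow hB hsupp (map_closureIdeal.le.trans h𝔟m) fun v hv => ?_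
    obtain ⟨i, hi⟩ := hg2 v hv
    exact ⟨g i, map_closureIdeal.ge (Ideal.mem_sup_left (Ideal.subset_span ⟨i, rfl⟩)), hi⟩
  · rw [length_closureScheme hB hN𝔟 h𝔟]
    exact (hr N (le_max_left _ _)).2
  · rw [taylorPart_homogenize hB (hgm i) (le_max_left _ _) hk.le, if_neg hk.ne]
  · rw [taylorPart_homogenize hB (hgm i) (le_max_left _ _) le_rfl, if_pos rfl]
    intro h
    apply hg0 i
    rw [← dehom_cone B (homogeneousComponent m (g i)), h, map_zero]
  -- Every plane contains a vector off the line of `P`. Its direction is nonzero, and the Taylor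
  -- form depends on this direction only.
  · obtain ⟨w, hw, hwP⟩ := exists_notMem_of_finrank_eq_two hW (B (Fin.cons 1 0))
    obtain ⟨a, v, rfl⟩ := exists_direction (B := B) w
    have hv : v ≠ 0 := by
      rintro rfl
      exact hwP a (by simpa using smul_frame_cons_add (B := B) a 0 1 0 0 0)
    obtain ⟨i, hi⟩ := hg2 v hv
    refine ⟨i, _, hw, ?_⟩
    rw [taylorPart_homogenize hB (hgm i) (le_max_left _ _) le_rfl, if_pos rfl, eval_cone,
      B.symm_apply_apply]
    simpa using hi
  · refine localIdeal_le_of_map_le hB (HomogeneousIdeal.isHomogeneous _) hspanH hu fun s hs => ?_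
    rw [hspan]
    exact hu𝔟 s (map_closureIdeal.le hs)
  · refine localIdeal_le_of_map_le hB hspanH (HomogeneousIdeal.isHomogeneous _) (u := 1) (by simp)
      fun s hs => ?_
    rw [one_mul]
    rw [hspan] at hs
    exact map_closureIdeal.ge (Ideal.mem_sup_left hs)

theorem length_le_length_of_le {Y Z : ClosedSubscheme n} (hY : Y.support = {P})
    (hZ : Z.support = {P}) (h : Y ≤ Z) : length Y.ideal ≤ length Z.ideal := by
  rw [length_eq_of_support_eq hY, length_eq_of_support_eq hZ]
  have hle : localIdeal Z.ideal.toIdeal P ≤ localIdeal Y.ideal.toIdeal P :=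
    Ideal.comap_mono (Ideal.map_mono h)
  exact Module.length_le_of_surjective (Submodule.factor hle) (Submodule.factor_surjective hle)

/-- Fat points of order `m` are `m`-symmetric. -/
theorem exists_isSymmetric (hm : 1 ≤ m) : ∃ Y : ClosedSubscheme n, IsSymmetric m Y := by
  let P : Point n := Projectivization.mk ℂ (Pi.single 0 1) (by simp)
  obtain ⟨B, hB⟩ := exists_frame P
  refine ⟨closureScheme B (idealOfVars (Fin n) ℂ ^ m), isSymmetric_of_le_pow hB
    (support_closureScheme hB le_rfl (Ideal.pow_le_self (by omega))) map_closureIdeal.le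
    fun v hv => ?_⟩
  obtain ⟨j, hj⟩ := Function.ne_iff.1 hv
  refine ⟨X j ^ m, map_closureIdeal.ge (isHomogeneous_X_pow j m).mem_pow_idealOfVars, ?_⟩
  rw [homogeneousComponent_eq_self (isHomogeneous_X_pow j m), map_pow, eval_X]
  exact pow_ne_zero m hj

end Superfat

end

/-! ### The main theorem. -/

theorem mainTheorem1 (n m : ℕ) (hm : 1 ≤ m) :
    (∀ Y : Superfat.ClosedSubscheme n, Superfat.IsSuperfat m Y →
      ∃ P : Superfat.Point n, Y.support = {P} ∧
        (∃ (G : Fin n → Superfat.CoordRing n) (d : Fin n → ℕ),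
          (∀ i, (G i).IsHomogeneous (d i)) ∧
          (∀ i, Superfat.HasMultiplicity (G i) P m) ∧
          (∀ W : Submodule ℂ (Fin (n + 1) → ℂ), Module.finrank ℂ W = 2 →
            ∃ i, ∃ w ∈ W, MvPolynomial.eval w (Superfat.taylorPart (G i) P m) ≠ 0) ∧
          Superfat.localIdeal Y.ideal.toIdeal P =
            Superfat.localIdeal (Ideal.span (Set.range G)) P) ∧
        Superfat.length Y.ideal = (m : ℕ∞) ^ n) ∧
    IsGreatest {l : ℕ∞ | ∃ Y : Superfat.ClosedSubscheme n,
      Superfat.IsSymmetric m Y ∧ Superfat.length Y.ideal = l} ((m : ℕ∞) ^ n) := by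
  refine ⟨fun Y hY => ?_, ?_, ?_⟩
  · obtain ⟨P, Z, hYP, -, hYZ, hZ, hlen, hG⟩ := Superfat.exists_le_complete_intersection hm hY.prop
    -- Maximality of `Y` among symmetric schemes forces it to coincide with the complete
    -- intersection containing it.
    have h : Y.ideal = Z.ideal := le_antisymm (hY.2 hZ hYZ) hYZ
    rw [h]
    exact ⟨P, hYP, hG, hlen⟩
  · obtain ⟨Y, hY⟩ := Superfat.exists_isSymmetric (n := n) hm
    obtain ⟨P, Z, -, -, -, hZ, hlen, -⟩ := Superfat.exists_le_complete_intersection hm hY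
    exact ⟨Z, hZ, hlen⟩
  · rintro _ ⟨Y, hY, rfl⟩
    obtain ⟨P, Z, hYP, hZP, hYZ, -, hlen, -⟩ := Superfat.exists_le_complete_intersection hm hY
    rw [← hlen]
    exact Superfat.length_le_length_of_le hYP hZP hYZ
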